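/- For $\alpha=(\alpha_1,\alpha_2)\in\mathbb N^2$ put $|\alpha|=\alpha_1+\alpha_2$. For $j\ge 0$ let $V_j$ be the set of formal power series $\mathbf f=\sum_{\alpha}\mathbf f_\alpha z^\alpha\in\mathbb C^2[[z_1,z_2]]$ with $\mathbf f_\alpha=0$ for all $|\alpha|\le j$. Consider sequences $(M_k)_{k\ge1}$ of positive real numbers satisfying 0) $\inf_{k\ge1}M_k^{1/k}>0$; 1) there is $C_1>0$ with $M_{k+1}\le C_1^{k+1}M_k$ for all $k\ge1$; 2) $(M_k)_{k\ge 1}$ is logarithmically convex; 3) $M_kM_l\le M_{k+l-1}$ for all $k,l\ge1$, and let $\mathcal C_{M_k}$ be the set of formal power series $\mathbf f$ for which there are $A,B>0$ with $|\mathbf f_\alpha|\le A\,B^{|\alpha|}M_{|\alpha|}$ for all $\alpha\neq0$. Let $\omega>0$ be irrational, let $(p_k/q_k)_{k\ge0}$ be the convergents of its continued fraction, and call $\omega$ a Bruno number if $\sum_{k\ge0}\frac{\log q_{k+1}}{q_k}<\infty$. For $|\alpha|\ge 1$ let $\kappa(\alpha)$ be the integer with $q_{\kappa(\alpha)}\le|\alpha|<q_{\kappa(\alpha)+1}$.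 Let $$\mathbf F(z)=A z+\mathbf f(z),\qquad A=\operatorname{diag}(-1,\omega),\quad \mathbf f\in V_1,$$ be a formal vector field on $\mathbb C^2$, and let $(M_k)_{k\ge1}$, $(N_k)_{k\ge1}$ be two sequences satisfying 0)–3). Then there is a unique $\mathbf h\in V_1$ (the linearization of $\mathbf F$) such that the change of variables $z=w+\mathbf h(w)$ transforms $\dot z=\mathbf F(z)$ into $\dot w=Aw$, i.e. such that $D(\mathrm{id}+\mathbf h)(w)\,Aw=\mathbf F(w+\mathbf h(w))$ as formal power series, and: 1. If $\mathbf F\in\mathcal C_{M_k}$ and $\omega$ is a Bruno number, then $\mathbf h\in\mathcal C_{M_k}\cap V_1$. 2. If $\mathbf F$ is analytic (convergent) near the origin and $$\limsup_{|\alpha|\to+\infty}\Big(\sum_{m=0}^{\kappa(\alpha)}\frac{\log q_{m+1}}{q_m}-\frac1{|\alpha|}\log N_{|\alpha|}\Big)<+\infty,$$ then $\mathbf h\in\mathcal C_{N_k}\cap V_1$. 3. If $\mathbf F\in\mathcal C_{M_k}$, $N_k\ge M_k$ for all sufficiently large $k$, and $$\limsup_{|\alpha|\to+\infty}\Big(\sum_{m=0}^{\kappa(\alpha)}\frac{\log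 q_{m+1}}{q_m}-\frac1{|\alpha|}\log\frac{N_{|\alpha|}}{M_{|\alpha|}}\Big)<+\infty,$$ then $\mathbf h\in\mathcal C_{N_k}\cap V_1$. -/

import Mathlib

open Filter

namespace UltraVF

noncomputable section

/-- `ℂⁿ[[z₁, …, zₙ]]`: formal power series in `n` variables with coefficients in `ℂⁿ`, given by
their `n` components. -/
abbrev VSeries (n : ℕ) : Type := Fin n → MvPowerSeries (Fin n) ℂ

/-- The coefficient `f_α ∈ ℂⁿ` of `z^α`. -/
def vcoeff {n : ℕ} (f : VSeries n) (α : Fin n →₀ ℕ) : Fin n → ℂ :=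
  fun i => MvPowerSeries.coeff α (f i)

/-- `V_j`: the series all of whose coefficients of total degree at most `j` vanish. -/
def V (n j : ℕ) : Set (VSeries n) :=
  {f | ∀ α : Fin n →₀ ℕ, α.degree ≤ j → vcoeff f α = 0}

/-- The conditions on a sequence of positive numbers `(M_k)_{k ≥ 1}` which serves as a weight
sequence; the value `M 0` plays no role. -/
structure IsWeightSeq (M : ℕ → ℝ) : Prop where
  pos : ∀ k : ℕ, 1 ≤ k → 0 < M k
  inf_root_pos : 0 < ⨅ k : ℕ+, M k ^ (1 / (k : ℝ))
  growth : ∃ C₁ : ℝ, 0 < C₁ ∧ ∀ k : ℕ, 1 ≤ k → M (k + 1) ≤ C₁ ^ (k + 1) * M k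
  logConvex : ∀ k : ℕ, 1 ≤ k → M (k + 1) ^ 2 ≤ M k * M (k + 2)
  mul_le : ∀ k l : ℕ, 1 ≤ k → 1 ≤ l → M k * M l ≤ M (k + l - 1)

/-- The class `C_{M_k}`: `|f_α| ≤ A B^{|α|} M_{|α|}`. Since `M_k` is only given for `k ≥ 1`, the
constant term (one coefficient, zero for all the series considered here) is not constrained. -/
def weightClass (n : ℕ) (M : ℕ → ℝ) : Set (VSeries n) :=
  {f | ∃ A B : ℝ, 0 < A ∧ 0 < B ∧
    ∀ α : Fin n →₀ ℕ, α ≠ 0 → ‖vcoeff f α‖ ≤ A * B ^ α.degree * M α.degree}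

/-- `f` is (the Taylor series of) an analytic germ at the origin: it converges absolutely on some
polydisc around `0`. -/
def IsAnalyticGerm {n : ℕ} (f : VSeries n) : Prop :=
  ∃ r : ℝ, 0 < r ∧ Summable fun α : Fin n →₀ ℕ => ‖vcoeff f α‖ * r ^ α.degree

/-- The linear vector field `A z` with `A = diag(lam)`. -/
def linearField {n : ℕ} (lam : Fin n → ℂ) : VSeries n :=
  fun i => MvPowerSeries.C (lam i) * MvPowerSeries.X i

/-- The change of variables `z = w + h(w)`. -/
def changeVar {n : ℕ} (h : VSeries n) : VSeries n :=
  fun i => MvPowerSeries.X i + h i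

/-- `h` is a linearization of the vector field `F` with linear part `diag(lam)`: `h ∈ V_1`, and the
change of variables `z = H(w) = w + h(w)` transforms `dz/dt = F(z)` into `dw/dt = A w`, that is
`DH(w) A w = F(H(w))` as formal power series. -/
def IsLinearization {n : ℕ} (lam : Fin n → ℂ) (F h : VSeries n) : Prop :=
  h ∈ V n 1 ∧ ∀ j : Fin n,
    ∑ i, linearField lam i * MvPowerSeries.pderiv ℂ i (changeVar h j) =
      MvPowerSeries.subst (changeVar h) (F j)

/-- The substitution in the definition above is a genuine one, since `H` has no constant term. -/
theorem hasSubst_changeVar {n : ℕ} {h : VSeries n} (hh : h ∈ V n 1) :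
    MvPowerSeries.HasSubst (changeVar h) := by
  apply MvPowerSeries.hasSubst_of_constantCoeff_zero
  intro i
  have h0 := congrFun (hh 0 (by simp)) i
  simpa [changeVar, vcoeff] using h0

/-- The denominators `q_k` of the convergents `p_k / q_k`, `k = 0, 1, …`, of the regular continued
fraction `[a₀; a₁, a₂, …]` of `ω`; thus `q_0 = 1`, `q_1 = a₁`. -/
def convDen (ω : ℝ) (k : ℕ) : ℝ := (GenContFract.of ω).dens k

/-- Bruno numbers: irrational numbers with `∑ log q_{k+1} / q_k < ∞`. -/
def IsBruno (ω : ℝ) : Prop :=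
  Irrational ω ∧ Summable fun k : ℕ => Real.log (convDen ω (k + 1)) / convDen ω k

/-- The integer `κ` with `q_κ ≤ N < q_{κ+1}`. -/
def kappa (ω : ℝ) (N : ℕ) : ℕ := sInf {k : ℕ | (N : ℝ) < convDen ω (k + 1)}

theorem exists_lt_convDen {ω : ℝ} (hω : Irrational ω) (N : ℕ) :
    ∃ k : ℕ, (N : ℝ) < convDen ω (k + 1) := by
  have hnt : ∀ k, ¬ (GenContFract.of ω).TerminatedAt k := by
    intro k hk
    obtain ⟨q, hq⟩ := (GenContFract.terminates_iff_rat ω).1 ⟨k, hk⟩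
    exact hω ⟨q, hq.symm⟩
  refine ⟨N + 5, lt_of_lt_of_le ?_ (GenContFract.succ_nth_fib_le_of_nth_den (Or.inr (hnt _)))⟩
  have h1 : N + 7 ≤ Nat.fib (N + 7) := Nat.le_fib_self (by omega)
  have h2 : N < Nat.fib (N + 5 + 1 + 1) := by
    have : N + 5 + 1 + 1 = N + 7 := by ring
    rw [this]
    omega
  exact_mod_cast h2

theorem kappa_spec {ω : ℝ} (hω : Irrational ω) {N : ℕ} (hN : 1 ≤ N) :
    convDen ω (kappa ω N) ≤ N ∧ (N : ℝ) < convDen ω (kappa ω N + 1) := by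
  refine ⟨?_, Nat.sInf_mem (s := {k : ℕ | (N : ℝ) < convDen ω (k + 1)})
    (exists_lt_convDen hω N)⟩
  rcases hk : kappa ω N with _ | k
  · have : convDen ω 0 = 1 := GenContFract.zeroth_den_eq_one
    rw [this]
    exact_mod_cast hN
  · by_contra hlt
    have hle : kappa ω N ≤ k :=
      Nat.sInf_le (s := {k : ℕ | (N : ℝ) < convDen ω (k + 1)}) (not_le.1 hlt)
    omega

theorem kappa_unique {ω : ℝ} {N k : ℕ} (h1 : convDen ω k ≤ N)
    (h2 : (N : ℝ) < convDen ω (k + 1)) : kappa ω N = k := by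
  have hmono : Monotone (convDen ω) := monotone_nat_of_le_succ fun _ => GenContFract.of_den_mono
  have hmem : k ∈ {k : ℕ | (N : ℝ) < convDen ω (k + 1)} := h2
  refine le_antisymm (Nat.sInf_le hmem) ?_
  by_contra hlt
  have h3 : (N : ℝ) < convDen ω (kappa ω N + 1) := Nat.sInf_mem ⟨k, hmem⟩
  have h4 : convDen ω (kappa ω N + 1) ≤ convDen ω k := hmono (by omega)
  linarith

/-- `∑_{m=0}^{κ(α)} log q_{m+1} / q_m`, where `q_{κ(α)} ≤ |α| < q_{κ(α)+1}`. -/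
def brunoPartialSum (ω : ℝ) (α : Fin 2 →₀ ℕ) : ℝ :=
  ∑ m ∈ Finset.range (kappa ω α.degree + 1), Real.log (convDen ω (m + 1)) / convDen ω m

/-- `limsup_{|α| → ∞} u(α) < +∞`, the upper limit being taken in `[-∞, +∞]`. -/
def LimsupFinite (u : (Fin 2 →₀ ℕ) → ℝ) : Prop :=
  limsup (fun α => (u α : EReal)) (comap (fun α : Fin 2 →₀ ℕ => α.degree) atTop) < ⊤

end

end UltraVF

/-! Comparing coefficients, linearization means that `(λ·α - λ_j) h_{j,α}` is the coefficient at `α`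
of the `j`-th component of `f ∘ (id + h)`. As `f` has order at least 2, that coefficient involves
only lower-degree coefficients of `h`, and irrationality keeps the divisors nonzero for `|α| ≥ 2`.
This recursion gives existence and uniqueness.

For `λ = (-1, ω)` and `|α| = w + 1`, every divisor has the form `q(1 + ω) - w` with `q` an integer,
so its modulus is at least `divisorDist ω w`: the estimate becomes one-dimensional in `w`. Let `s w`
be the sum of the absolute values of the coefficients of `id + h` in degree `w + 1`. If `K` is
superadditive and increasing and its step from `w` to `w + 1` pays for `-log (divisorDist ω (w +
1))`, then `s w / (M (w + 1) * exp (K w))` satisfies a majorant recursion without small divisors,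
hence grows geometrically (`weighted_bound_of_recursive`). Condition 3) makes `M (w + 1)`
supermultiplicative in `w`, which lets the weights pass through products.

It remains to find `K` bounded by `w` times a constant plus the partial Bruno sum. Put `W_k = p_k +
q_k` and `E_k = W_k q_{k+1} / (4 q_k)`. By best approximation, resonances of level `k` less than
`E_k` apart differ by multiples of `W_k` (`cfSum_dvd`). Consequently the cost `u / W_k + (2u / E_k -
1)⁺` of a resonance `u` exceeds by at least 1 the total cost of any list of resonances with sum
below `u` (`sum_cost_add_one_le`). The maximal total cost of lists with sum at most `w` is therefore
superadditive and jumps by 1 at each resonance. Weighting level `k` by `log (8 q_{k+1})` and summing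
gives `potential`; since `W_k ≥ q_k` and `E_k ≥ q_{k+1} / 4`, level `k` contributes the Bruno term
plus a summable error (`levelPotential_le`). -/

namespace UltraVF

noncomputable section

/-! ### Continued fractions: convergents, errors, best approximation -/

/-- The complete quotients `x₀ = ω`, `x_{k+1} = 1 / {x_k}` of the continued fraction of `ω`. -/
def completeQuot (ω : ℝ) (k : ℕ) : ℝ := (fun x : ℝ => (Int.fract x)⁻¹)^[k] ω

theorem completeQuot_succ (ω : ℝ) (k : ℕ) :
    completeQuot ω (k + 1) = (Int.fract (completeQuot ω k))⁻¹ :=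
  Function.iterate_succ_apply' _ _ _

theorem completeQuot_succ' (ω : ℝ) (k : ℕ) :
    completeQuot ω (k + 1) = completeQuot (Int.fract ω)⁻¹ k :=
  Function.iterate_succ_apply _ _ _

theorem irrational_fract {x : ℝ} (hx : Irrational x) : Irrational (Int.fract x) :=
  hx.sub_intCast _

theorem irrational_completeQuot {ω : ℝ} (hω : Irrational ω) (k : ℕ) :
    Irrational (completeQuot ω k) := by
  induction k with
  | zero => exact hω
  | succ k ih =>
    rw [completeQuot_succ]
    exact (irrational_fract ih).inv

theorem fract_pos_of_irrational {x : ℝ} (hx : Irrational x) : 0 < Int.fract x :=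
  lt_of_le_of_ne (Int.fract_nonneg x) (Ne.symm (irrational_fract hx).ne_zero)

theorem of_s_get?_eq {ω : ℝ} (hω : Irrational ω) (n : ℕ) :
    (GenContFract.of ω).s.get? n = some ⟨1, (⌊completeQuot ω (n + 1)⌋ : ℝ)⟩ := by
  induction n generalizing ω with
  | zero =>
    exact GenContFract.of_s_head (irrational_fract hω).ne_zero
  | succ n ih =>
    rw [GenContFract.of_s_succ, ih (irrational_fract hω).inv, completeQuot_succ' ω]

/-- The solutions of the recurrence `u_{k+2} = a_{k+1} u_{k+1} + u_k` satisfied by the numerators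
and the denominators of the convergents, where `a_k` are the partial quotients of `ω`. -/
def contSeq (ω : ℝ) (u v : ℤ) : ℕ → ℤ
  | 0 => u
  | 1 => v
  | k + 2 => ⌊completeQuot ω (k + 1)⌋ * contSeq ω u v (k + 1) + contSeq ω u v k

/-- Numerators of the convergents, with the index shifted by one. -/
def cfNum (ω : ℝ) : ℕ → ℤ := contSeq ω 1 ⌊ω⌋

/-- Denominators of the convergents, with the index shifted by one. -/
def cfDen (ω : ℝ) : ℕ → ℤ := contSeq ω 0 1

theorem contsAux_b_eq {ω : ℝ} (hω : Irrational ω) (k : ℕ) :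
    ((GenContFract.of ω).contsAux k).b = cfDen ω k := by
  induction k using Nat.twoStepInduction with
  | zero => simp [cfDen, contSeq, GenContFract.contsAux]
  | one => simp [cfDen, contSeq, GenContFract.contsAux]
  | more k h0 h1 =>
    rw [GenContFract.contsAux_recurrence (of_s_get?_eq hω k) rfl rfl]
    simp only [h0, h1, cfDen, contSeq]
    push_cast
    ring

theorem convDen_eq {ω : ℝ} (hω : Irrational ω) (k : ℕ) : convDen ω k = cfDen ω (k + 1) :=
  contsAux_b_eq hω (k + 1)

theorem one_le_floor_completeQuot {ω : ℝ} (hω : Irrational ω) (k : ℕ) :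
    1 ≤ ⌊completeQuot ω (k + 1)⌋ := by
  rw [Int.le_floor, completeQuot_succ]
  have := fract_pos_of_irrational (irrational_completeQuot hω k)
  simpa using (one_le_inv₀ this).2 (Int.fract_lt_one _).le

theorem contSeq_nonneg {ω : ℝ} (hω : Irrational ω) {u v : ℤ} (hu : 0 ≤ u) (hv : 0 ≤ v) (k : ℕ) :
    0 ≤ contSeq ω u v k := by
  induction k using Nat.twoStepInduction with
  | zero => exact hu
  | one => exact hv
  | more k h0 h1 =>
    have := one_le_floor_completeQuot hω k
    simp only [contSeq]
    positivity

theorem contSeq_mono {ω : ℝ} (hω : Irrational ω) {u v : ℤ} (hu : 0 ≤ u) (hv : 0 ≤ v) (k : ℕ) :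
    contSeq ω u v (k + 1) ≤ contSeq ω u v (k + 2) := by
  have h0 := contSeq_nonneg hω hu hv k
  have h1 := contSeq_nonneg hω hu hv (k + 1)
  have := one_le_floor_completeQuot hω k
  simp only [contSeq]
  nlinarith

theorem one_le_cfDen_succ {ω : ℝ} (hω : Irrational ω) (k : ℕ) : 1 ≤ cfDen ω (k + 1) := by
  induction k with
  | zero => simp [cfDen, contSeq]
  | succ k ih => exact ih.trans (contSeq_mono hω le_rfl zero_le_one k)

theorem cfDen_nonneg {ω : ℝ} (hω : Irrational ω) (k : ℕ) : 0 ≤ cfDen ω k :=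
  contSeq_nonneg hω le_rfl zero_le_one k

theorem cfDen_le_succ {ω : ℝ} (hω : Irrational ω) (k : ℕ) : cfDen ω k ≤ cfDen ω (k + 1) := by
  cases k with
  | zero => simp [cfDen, contSeq]
  | succ k => exact contSeq_mono hω le_rfl zero_le_one k

theorem cfNum_nonneg {ω : ℝ} (hpos : 0 < ω) (hω : Irrational ω) (k : ℕ) : 0 ≤ cfNum ω k :=
  contSeq_nonneg hω zero_le_one (Int.floor_nonneg.2 hpos.le) k

/-- The absolute values `|q_k ω - p_k|`, with the index shifted by one. -/
def cfErr (ω : ℝ) : ℕ → ℝ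
  | 0 => 1
  | k + 1 => Int.fract (completeQuot ω k) * cfErr ω k

theorem cfErr_pos {ω : ℝ} (hω : Irrational ω) (k : ℕ) : 0 < cfErr ω k := by
  induction k with
  | zero => exact one_pos
  | succ k ih => exact mul_pos (fract_pos_of_irrational (irrational_completeQuot hω k)) ih

theorem cfErr_succ_le {ω : ℝ} (hω : Irrational ω) (k : ℕ) : cfErr ω (k + 1) ≤ cfErr ω k :=
  mul_le_of_le_one_left (cfErr_pos hω k).le (Int.fract_lt_one _).le

theorem cfErr_recurrence {ω : ℝ} (hω : Irrational ω) (k : ℕ) :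
    cfErr ω k = ⌊completeQuot ω (k + 1)⌋ * cfErr ω (k + 1) + cfErr ω (k + 2) := by
  have h : (⌊completeQuot ω (k + 1)⌋ : ℝ) + Int.fract (completeQuot ω (k + 1)) =
      (Int.fract (completeQuot ω k))⁻¹ := by
    rw [Int.floor_add_fract, completeQuot_succ]
  have hne := (fract_pos_of_irrational (irrational_completeQuot hω k)).ne'
  have : cfErr ω (k + 2) = Int.fract (completeQuot ω (k + 1)) * cfErr ω (k + 1) := rfl
  rw [this, ← add_mul, h]
  simp only [cfErr]
  field_simp

/-- The errors alternate in sign; this is what prevents cancellation in `cfErr_le_abs`. -/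
theorem cfErr_eq {ω : ℝ} (hω : Irrational ω) (k : ℕ) :
    ω * cfDen ω k - cfNum ω k = (-1) ^ (k + 1) * cfErr ω k := by
  induction k using Nat.twoStepInduction with
  | zero => simp [cfDen, cfNum, contSeq, cfErr]
  | one =>
    change ω * ((1 : ℤ) : ℝ) - ⌊ω⌋ = (-1) ^ 2 * (Int.fract ω * 1)
    rw [← Int.self_sub_floor]
    push_cast
    ring
  | more k h0 h1 =>
    have h := cfErr_recurrence hω k
    have e1 : (cfDen ω (k + 2) : ℝ) =
        ⌊completeQuot ω (k + 1)⌋ * cfDen ω (k + 1) + cfDen ω k := by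
      simp [cfDen, contSeq]
    have e2 : (cfNum ω (k + 2) : ℝ) =
        ⌊completeQuot ω (k + 1)⌋ * cfNum ω (k + 1) + cfNum ω k := by
      simp [cfNum, contSeq]
    rw [e1, e2]
    rw [h] at h0
    simp only [pow_succ] at *
    linear_combination h0 + ⌊completeQuot ω (k + 1)⌋ * h1

/-- The left side is invariant under the common recurrence and equals 1 at the start. Its two
summands give upper and lower bounds for the errors. -/
theorem cfErr_mul_add {ω : ℝ} (hω : Irrational ω) (k : ℕ) :
    cfErr ω k * cfDen ω (k + 1) + cfErr ω (k + 1) * cfDen ω k = 1 := by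
  induction k with
  | zero => simp [cfErr, cfDen, contSeq]
  | succ k ih =>
    have e1 : (cfDen ω (k + 2) : ℝ) =
        ⌊completeQuot ω (k + 1)⌋ * cfDen ω (k + 1) + cfDen ω k := by
      simp [cfDen, contSeq]
    rw [e1, ← ih, cfErr_recurrence hω k]
    ring

theorem cfNum_mul_cfDen_sub (ω : ℝ) (k : ℕ) :
    cfNum ω k * cfDen ω (k + 1) - cfNum ω (k + 1) * cfDen ω k = (-1) ^ k := by
  induction k with
  | zero => simp [cfNum, cfDen, contSeq]
  | succ k ih =>
    have e1 : cfDen ω (k + 2) =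
        ⌊completeQuot ω (k + 1)⌋ * cfDen ω (k + 1) + cfDen ω k := rfl
    have e2 : cfNum ω (k + 2) =
        ⌊completeQuot ω (k + 1)⌋ * cfNum ω (k + 1) + cfNum ω k := rfl
    rw [e1, e2, pow_succ, ← ih]
    ring

/-- Best approximation, measured by `p + q` rather than by `q`. In the unimodular basis of two
consecutive convergents, coordinates of equal sign would put `p + q` outside the allowed range; with
opposite signs the alternating errors add up. -/
theorem cfErr_le_abs {ω : ℝ} (hpos : 0 < ω) (hω : Irrational ω) (k : ℕ) {p q : ℤ}
    (h0 : 0 < p + q) (h1 : p + q < cfNum ω (k + 1) + cfDen ω (k + 1)) :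
    cfErr ω k ≤ |ω * q - p| := by
  obtain ⟨s, hs, hs2⟩ : ∃ s : ℤ, s = (-1) ^ k ∧ s * s = 1 :=
    ⟨(-1) ^ k, rfl, by rw [← mul_pow]; norm_num⟩
  have hdet := cfNum_mul_cfDen_sub ω k
  rw [← hs] at hdet
  -- Cramer's rule; the determinant `s` is its own inverse.
  obtain ⟨x, hx⟩ : ∃ x, x = s * (p * cfDen ω (k + 1) - q * cfNum ω (k + 1)) := ⟨_, rfl⟩
  obtain ⟨y, hy⟩ : ∃ y, y = s * (q * cfNum ω k - p * cfDen ω k) := ⟨_, rfl⟩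
  have hp : p = x * cfNum ω k + y * cfNum ω (k + 1) := by
    rw [hx, hy]
    linear_combination (-p) * hs2 - s * p * hdet
  have hq : q = x * cfDen ω k + y * cfDen ω (k + 1) := by
    rw [hx, hy]
    linear_combination (-q) * hs2 - s * q * hdet
  have hW : 0 < cfNum ω (k + 1) + cfDen ω (k + 1) := by
    have := cfNum_nonneg hpos hω (k + 1)
    have := one_le_cfDen_succ hω k
    omega
  have hW0 : 0 ≤ cfNum ω k + cfDen ω k :=
    add_nonneg (cfNum_nonneg hpos hω k) (cfDen_nonneg hω k)
  have hw : p + q = x * (cfNum ω k + cfDen ω k) + y * (cfNum ω (k + 1) + cfDen ω (k + 1)) := by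
    rw [hp, hq]; ring
  have hval : ω * q - p = (-1) ^ (k + 1) * (x * cfErr ω k - y * cfErr ω (k + 1)) := by
    have e0 := cfErr_eq hω k
    have e1 := cfErr_eq hω (k + 1)
    rw [hp, hq]
    push_cast
    simp only [pow_succ] at *
    linear_combination (x : ℝ) * e0 + (y : ℝ) * e1
  rw [hval, abs_mul, abs_pow, abs_neg, abs_one, one_pow, one_mul]
  have p0 := cfErr_pos hω k
  have p1 := cfErr_pos hω (k + 1)
  rcases le_or_gt x 0 with hx0 | hx0
  · rcases le_or_gt y 0 with hy0 | hy0
    · nlinarith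
    · have hx1 : x ≤ -1 := by
        by_contra hne
        have : x = 0 := by omega
        subst this
        nlinarith
      have hx1' : (x : ℝ) ≤ -1 := by exact_mod_cast hx1
      have hy' : (0 : ℝ) ≤ y := by exact_mod_cast hy0.le
      rw [le_abs]
      right
      nlinarith
  · rcases le_or_gt y 0 with hy0 | hy0
    · have hx1' : (1 : ℝ) ≤ x := by exact_mod_cast hx0
      have hy' : (y : ℝ) ≤ 0 := by exact_mod_cast hy0
      rw [le_abs]
      left
      nlinarith
    · nlinarith

/-! ### Small divisors as distances to the multiples of `1 + ω` -/

/-- The distance from an integer `w` to the nearest multiple of `1 + ω`. -/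
def divisorDist (ω : ℝ) (w : ℤ) : ℝ := ‖((w : ℝ) : AddCircle (1 + ω))‖

theorem divisorDist_le {ω : ℝ} (w q : ℤ) : divisorDist ω w ≤ |q * (1 + ω) - w| := by
  have : ((w : ℝ) : AddCircle (1 + ω)) = ((w - q * (1 + ω) : ℝ) : AddCircle (1 + ω)) := by
    rw [AddCircle.coe_sub, eq_comm, sub_eq_self]
    have h := AddCircle.coe_period (1 + ω)
    have h2 : ((q * (1 + ω) : ℝ) : AddCircle (1 + ω)) = q • ((1 + ω : ℝ) : AddCircle (1 + ω)) := by
      rw [← AddCircle.coe_zsmul, zsmul_eq_mul]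
    rw [h2, h, smul_zero]
  rw [divisorDist, this, abs_sub_comm]
  exact QuotientAddGroup.norm_mk_le_norm

theorem exists_divisorDist_eq (ω : ℝ) (w : ℤ) :
    ∃ q : ℤ, divisorDist ω w = |q * (1 + ω) - w| :=
  ⟨_, by rw [divisorDist, AddCircle.norm_eq, abs_sub_comm]⟩

theorem divisorDist_add_le (ω : ℝ) (v w : ℤ) :
    divisorDist ω (v + w) ≤ divisorDist ω v + divisorDist ω w := by
  simp only [divisorDist, Int.cast_add, AddCircle.coe_add]
  exact norm_add_le _ _

theorem divisorDist_neg (ω : ℝ) (w : ℤ) : divisorDist ω (-w) = divisorDist ω w := by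
  simp only [divisorDist, Int.cast_neg, AddCircle.coe_neg, norm_neg]

theorem divisorDist_natCast_mul_le (ω : ℝ) (m : ℕ) (w : ℤ) :
    divisorDist ω (m * w) ≤ m * divisorDist ω w := by
  induction m with
  | zero => simp [divisorDist]
  | succ m ih =>
    have := divisorDist_add_le ω (m * w) w
    push_cast
    rw [add_mul, one_mul, add_mul, one_mul]
    linarith

theorem divisorDist_pos {ω : ℝ} (hω : Irrational ω) {w : ℤ} (hw : w ≠ 0) :
    0 < divisorDist ω w := by
  obtain ⟨q, hq⟩ := exists_divisorDist_eq ω w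
  rw [hq, abs_pos]
  intro h
  rcases eq_or_ne q 0 with rfl | hq0
  · apply hw
    simpa using h
  · have h1 : Irrational (q * (1 + ω)) := by
      rw [add_comm]
      exact_mod_cast (hω.add_intCast 1).intCast_mul hq0
    exact h1 ⟨w, by push_cast; linarith⟩

/-- `W_k = p_k + q_k`. -/
def cfSum (ω : ℝ) (k : ℕ) : ℕ := (cfNum ω (k + 1) + cfDen ω (k + 1)).toNat

theorem cfSum_cast {ω : ℝ} (hpos : 0 < ω) (hω : Irrational ω) (k : ℕ) :
    (cfSum ω k : ℤ) = cfNum ω (k + 1) + cfDen ω (k + 1) :=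
  Int.toNat_of_nonneg (add_nonneg (cfNum_nonneg hpos hω _) (cfDen_nonneg hω _))

theorem one_le_convDen {ω : ℝ} (hω : Irrational ω) (k : ℕ) : 1 ≤ convDen ω k := by
  rw [convDen_eq hω]
  exact_mod_cast one_le_cfDen_succ hω k

theorem convDen_le_cfSum {ω : ℝ} (hpos : 0 < ω) (hω : Irrational ω) (k : ℕ) :
    convDen ω k ≤ cfSum ω k := by
  rw [convDen_eq hω]
  have h1 := cfSum_cast hpos hω k
  have h2 := cfNum_nonneg hpos hω (k + 1)
  have h3 : cfDen ω (k + 1) ≤ (cfSum ω k : ℤ) := by omega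
  exact_mod_cast h3

/-- With `p = r - q`, best approximation bounds the distance below by `cfErr ω k`, which occurs in
the larger summand of `cfErr_mul_add`. -/
theorem divisorDist_ge {ω : ℝ} (hpos : 0 < ω) (hω : Irrational ω) (k : ℕ) {r : ℤ}
    (h0 : 0 < r) (h1 : r < cfSum ω k) : 1 / (2 * convDen ω k) ≤ divisorDist ω r := by
  obtain ⟨q, hq⟩ := exists_divisorDist_eq ω r
  rw [cfSum_cast hpos hω] at h1
  have h := cfErr_le_abs hpos hω k (p := r - q) (q := q) (by omega) (by omega)
  have e : ω * q - (r - q : ℤ) = q * (1 + ω) - r := by push_cast; ring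
  rw [e, ← hq] at h
  refine le_trans ?_ h
  have hd := one_le_convDen hω k
  rw [convDen_eq hω] at *
  rw [div_le_iff₀ (by positivity), ← cfErr_mul_add hω k]
  have h2 : (cfDen ω k : ℝ) ≤ cfDen ω (k + 1) := by exact_mod_cast cfDen_le_succ hω k
  have h3 : (0 : ℝ) ≤ cfDen ω k := by exact_mod_cast cfDen_nonneg hω k
  have h4 := cfErr_succ_le hω k
  have h5 := cfErr_pos hω (k + 1)
  have : cfErr ω (k + 1) * cfDen ω k ≤ cfErr ω k * cfDen ω (k + 1) :=
    mul_le_mul h4 h2 h3 (cfErr_pos hω k).le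
  linarith

/-- The multiple `q_k (1 + ω)` lies at distance `|q_k ω - p_k|` from `p_k + q_k`. -/
theorem divisorDist_cfSum_le {ω : ℝ} (hpos : 0 < ω) (hω : Irrational ω) (k : ℕ) :
    divisorDist ω (cfSum ω k) ≤ 1 / convDen ω (k + 1) := by
  have h := divisorDist_le (ω := ω) (cfSum ω k) (cfDen ω (k + 1))
  refine h.trans ?_
  rw [cfSum_cast hpos hω, convDen_eq hω]
  have e : (cfDen ω (k + 1) * (1 + ω) - (cfNum ω (k + 1) + cfDen ω (k + 1) : ℤ) : ℝ) =
      ω * cfDen ω (k + 1) - cfNum ω (k + 1) := by push_cast; ring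
  rw [e, cfErr_eq hω, abs_mul, abs_pow, abs_neg, abs_one, one_pow, one_mul,
    abs_of_pos (cfErr_pos hω _)]
  have h1 : (1 : ℝ) ≤ cfDen ω (k + 1 + 1) := by exact_mod_cast one_le_cfDen_succ hω (k + 1)
  rw [le_div_iff₀ (by linarith), ← cfErr_mul_add hω (k + 1)]
  have h3 : (0 : ℝ) ≤ cfDen ω (k + 1) := by exact_mod_cast cfDen_nonneg hω _
  have := mul_nonneg (cfErr_pos hω (k + 2)).le h3
  linarith

theorem three_halves_pow_le_fib (n : ℕ) : (3 / 2 : ℝ) ^ n ≤ Nat.fib (n + 2) := by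
  induction n using Nat.twoStepInduction with
  | zero => simp
  | one => norm_num [Nat.fib_add_two]
  | more n h0 h1 =>
    rw [Nat.fib_add_two]
    push_cast
    have : (0 : ℝ) < (3 / 2) ^ n := by positivity
    calc (3 / 2 : ℝ) ^ (n + 2) ≤ (3 / 2) ^ n + (3 / 2) ^ (n + 1) := by
          rw [pow_succ, pow_succ]; linarith
      _ ≤ _ := add_le_add h0 h1

theorem three_halves_pow_le_convDen {ω : ℝ} (hω : Irrational ω) (k : ℕ) :
    (3 / 2 : ℝ) ^ k ≤ convDen ω (k + 1) := by
  refine (three_halves_pow_le_fib k).trans (GenContFract.succ_nth_fib_le_of_nth_den (Or.inr ?_))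
  intro hk
  obtain ⟨q, hq⟩ := (GenContFract.terminates_iff_rat ω).1 ⟨_, hk⟩
  exact hω ⟨q, hq.symm⟩

/-! ### Superadditive costs and the counting of resonances -/

/-- The excess `(2 u / E - 1)⁺`. -/
def excess (E : ℝ) (u : ℕ) : ℝ := max 0 (2 * u / E - 1)

theorem excess_nonneg (E : ℝ) (u : ℕ) : 0 ≤ excess E u := le_max_left _ _

theorem excess_mono {E : ℝ} (hE : 0 < E) {u v : ℕ} (h : u ≤ v) : excess E u ≤ excess E v := by
  unfold excess
  have : (u : ℝ) ≤ v := by exact_mod_cast h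
  gcongr

theorem excess_le {E : ℝ} (hE : 0 < E) (u : ℕ) : excess E u ≤ 2 * u / E :=
  max_le (by positivity) (by linarith)

theorem excess_add_le {E : ℝ} (hE : 0 < E) (u v : ℕ) :
    excess E u + excess E v ≤ excess E (u + v) := by
  have hu : 0 ≤ 2 * (u : ℝ) / E := by positivity
  have hv : 0 ≤ 2 * (v : ℝ) / E := by positivity
  have e : 2 * ((u + v : ℕ) : ℝ) / E = 2 * u / E + 2 * v / E := by push_cast; ring
  unfold excess
  rw [e]
  rcases max_cases 0 (2 * (u : ℝ) / E - 1) with h | h <;>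
  rcases max_cases 0 (2 * (v : ℝ) / E - 1) with h' | h' <;>
  rcases max_cases 0 (2 * (u : ℝ) / E + 2 * v / E - 1) with h'' | h'' <;> linarith [h.1, h'.1, h''.1]

theorem sum_excess_le {E : ℝ} (hE : 0 < E) (l : List ℕ) :
    (l.map (excess E)).sum ≤ excess E l.sum := by
  induction l with
  | nil => simpa using excess_nonneg E 0
  | cons u l ih =>
    simp only [List.map_cons, List.sum_cons]
    linarith [excess_add_le hE u l.sum]

/-- If at most one block has positive excess, the gap `E` below `v` gains at least 1; if there are
two, their two subtracted units do. The factor 2 in the excess makes it already 1 at `E`, which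
settles the empty list. -/
theorem sum_excess_add_one_le {E : ℝ} (hE : 0 < E) {v : ℕ} (hv : E ≤ v) (l : List ℕ)
    (hl : ∀ u ∈ l, E + u ≤ v) (hs : l.sum ≤ v) : (l.map (excess E)).sum + 1 ≤ excess E v := by
  have hv1 : 1 ≤ (v : ℝ) / E := (one_le_div hE).2 hv
  have hexv : excess E v = 2 * v / E - 1 := max_eq_right (by rw [mul_div_assoc]; linarith)
  induction l with
  | nil =>
    rw [hexv, mul_div_assoc]
    simp only [List.map_nil, List.sum_nil]
    linarith
  | cons u l ih =>
    simp only [List.map_cons, List.sum_cons, List.mem_cons, forall_eq_or_imp] at *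
    rcases max_cases 0 (2 * (u : ℝ) / E - 1) with h | h
    · have : excess E u = 0 := h.1
      rw [this, zero_add]
      exact ih hl.2 (by omega)
    · have hu : excess E u = 2 * u / E - 1 := h.1
      have h2 := sum_excess_le hE l
      have hs' : (u + l.sum : ℝ) ≤ v := by exact_mod_cast hs
      have e1 : 2 * (v : ℝ) / E - 2 * u / E = 2 * ((v - u) / E) := by ring
      have e2 : 1 ≤ ((v : ℝ) - u) / E := by rw [one_le_div hE]; linarith
      rcases max_cases 0 (2 * (l.sum : ℝ) / E - 1) with h' | h'
      · have h3 : excess E l.sum = 0 := by simpa [excess] using h'.1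
        rw [hu, hexv]
        linarith
      · have h3 : excess E l.sum = 2 * l.sum / E - 1 := by simpa [excess] using h'.1
        have h4 : 2 * (u : ℝ) / E + 2 * l.sum / E ≤ 2 * v / E := by
          rw [← add_div]; gcongr; linarith
        rw [hu, hexv]
        linarith

/-- The cost `u / Q + (2 u / E - 1)⁺` of a resonance of size `u`. -/
def cost (Q : ℕ) (E : ℝ) (u : ℕ) : ℝ := u / Q + excess E u

theorem cost_mono (Q : ℕ) {E : ℝ} (hE : 0 < E) {u v : ℕ} (h : u ≤ v) :
    cost Q E u ≤ cost Q E v := by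
  unfold cost
  have : (u : ℝ) ≤ v := by exact_mod_cast h
  have := excess_mono hE h
  gcongr

theorem sum_map_cost (Q : ℕ) (E : ℝ) (l : List ℕ) :
    (l.map (cost Q E)).sum = l.sum / Q + (l.map (excess E)).sum := by
  induction l with
  | nil => simp
  | cons u l ih =>
    simp only [List.map_cons, List.sum_cons, ih, cost]
    push_cast
    ring

theorem sum_cost_le (Q : ℕ) {E : ℝ} (hE : 0 < E) (l : List ℕ) :
    (l.map (cost Q E)).sum ≤ cost Q E l.sum := by
  rw [sum_map_cost, cost]
  linarith [sum_excess_le hE l]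

/-- A set of natural numbers whose elements, together with `0`, are congruent modulo `Q` as soon
as they are at distance less than `E`. -/
structure IsClustered (A : Set ℕ) (Q : ℕ) (E : ℝ) : Prop where
  pos : 0 < Q
  posE : 0 < E
  dvd : ∀ a ∈ A, (a : ℝ) < E → Q ∣ a
  dvd_sub : ∀ a ∈ A, ∀ b ∈ A, a ≤ b → (b : ℝ) < E + a → Q ∣ b - a

/-- If `v` is less than `E` away from 0 or from some `u` in the list, clustering forces `Q ∣ v -
l.sum`, since the remaining elements are also below `E`; then the linear part of the cost gains 1.
Otherwise the gap `E` makes the excess gain 1. -/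
theorem sum_cost_add_one_le {A : Set ℕ} {Q : ℕ} {E : ℝ} (hA : IsClustered A Q E) {v : ℕ}
    (hv : v ∈ A) (l : List ℕ) (hl : ∀ u ∈ l, u ∈ A) (hs : l.sum < v) :
    (l.map (cost Q E)).sum + 1 ≤ cost Q E v := by
  have hQ : (0 : ℝ) < Q := by exact_mod_cast hA.pos
  have hle : ∀ u ∈ l, u ≤ l.sum := fun u hu => List.le_sum_of_mem hu
  rw [sum_map_cost, cost]
  by_cases hcase : (v : ℝ) < E ∨ ∃ u ∈ l, (v : ℝ) < E + u
  · have hdvd : Q ∣ v - l.sum := by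
      rcases hcase with h | ⟨u, hu, h⟩
      · apply Nat.dvd_sub (hA.dvd v hv h)
        refine List.dvd_sum fun x hx => hA.dvd x (hl x hx) (lt_of_le_of_lt ?_ h)
        exact_mod_cast (hle x hx).trans hs.le
      · obtain ⟨l', hl'⟩ : ∃ l', l.Perm (u :: l') := ⟨_, List.perm_cons_erase hu⟩
        have hsum : l.sum = u + l'.sum := by rw [hl'.sum_eq, List.sum_cons]
        have e : v - l.sum = (v - u) - l'.sum := by omega
        rw [e]
        apply Nat.dvd_sub (hA.dvd_sub u (hl u hu) v hv (by omega) h)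
        refine List.dvd_sum fun x hx => hA.dvd x (hl x (hl'.mem_iff.2 (by simp [hx]))) ?_
        have h1 : x ≤ l'.sum := List.le_sum_of_mem hx
        have h2 : u + x ≤ v := by omega
        have h3 : (u + x : ℝ) ≤ v := by exact_mod_cast h2
        linarith
    have h1 : l.sum + Q ≤ v := by
      have := Nat.le_of_dvd (by omega) hdvd
      omega
    have h2 : (l.sum : ℝ) / Q + 1 ≤ v / Q := by
      rw [div_add_one hQ.ne']
      gcongr
      exact_mod_cast h1
    have h3 := (sum_excess_le hA.posE l).trans (excess_mono hA.posE hs.le)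
    linarith
  · push Not at hcase
    have h1 := sum_excess_add_one_le hA.posE hcase.1 l hcase.2 hs.le
    have h2 : (l.sum : ℝ) / Q ≤ v / Q := by
      gcongr
    linarith

/-- The total costs of the lists of elements of `A` with sum at most `n`. -/
def costSet (A : Set ℕ) (Q : ℕ) (E : ℝ) (n : ℕ) : Set ℝ :=
  {x | ∃ l : List ℕ, (∀ u ∈ l, u ∈ A) ∧ l.sum ≤ n ∧ x = (l.map (cost Q E)).sum}

/-- The largest total cost of a list of elements of `A` with sum at most `n`. -/
def maxCost (A : Set ℕ) (Q : ℕ) (E : ℝ) (n : ℕ) : ℝ := sSup (costSet A Q E n)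

section

variable {A : Set ℕ} {Q : ℕ} {E : ℝ}

theorem zero_mem_costSet (n : ℕ) : (0 : ℝ) ∈ costSet A Q E n := ⟨[], by simp, by simp, by simp⟩

theorem mem_upperBounds_costSet (hE : 0 < E) (n : ℕ) :
    cost Q E n ∈ upperBounds (costSet A Q E n) := by
  rintro x ⟨l, -, hs, rfl⟩
  exact (sum_cost_le Q hE l).trans (cost_mono Q hE hs)

theorem bddAbove_costSet (hE : 0 < E) (n : ℕ) : BddAbove (costSet A Q E n) :=
  ⟨_, mem_upperBounds_costSet hE n⟩

theorem maxCost_nonneg (hE : 0 < E) (n : ℕ) : 0 ≤ maxCost A Q E n :=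
  le_csSup (bddAbove_costSet hE n) (zero_mem_costSet n)

theorem maxCost_le (hE : 0 < E) (n : ℕ) : maxCost A Q E n ≤ cost Q E n :=
  csSup_le ⟨0, zero_mem_costSet n⟩ (mem_upperBounds_costSet hE n)

/-- Admissible lists for `m` and `n` concatenate to one for `m + n`. -/
theorem maxCost_add_le (hE : 0 < E) (m n : ℕ) :
    maxCost A Q E m + maxCost A Q E n ≤ maxCost A Q E (m + n) := by
  rw [← le_sub_iff_add_le]
  refine csSup_le ⟨0, zero_mem_costSet m⟩ ?_
  rintro x ⟨l, hl, hs, rfl⟩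
  rw [le_sub_comm]
  refine csSup_le ⟨0, zero_mem_costSet n⟩ ?_
  rintro x ⟨l', hl', hs', rfl⟩
  rw [le_sub_iff_add_le]
  refine le_csSup (bddAbove_costSet hE _) ⟨l' ++ l, ?_, ?_, ?_⟩
  · intro u hu
    rcases List.mem_append.1 hu with h | h
    exacts [hl' u h, hl u h]
  · rw [List.sum_append]; omega
  · rw [List.map_append, List.sum_append]

/-- The one-element list `[v + 1]` beats every list with sum at most `v` by 1. -/
theorem maxCost_add_one_le (hA : IsClustered A Q E) {v : ℕ} (hv : v + 1 ∈ A) :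
    maxCost A Q E v + 1 ≤ maxCost A Q E (v + 1) := by
  have h1 : cost Q E (v + 1) ≤ maxCost A Q E (v + 1) :=
    le_csSup (bddAbove_costSet hA.posE _) ⟨[v + 1], by simpa using hv, by simp, by simp⟩
  rw [← le_sub_iff_add_le]
  refine csSup_le ⟨0, zero_mem_costSet v⟩ ?_
  rintro x ⟨l, hl, hs, rfl⟩
  linarith [sum_cost_add_one_le hA hv l hl (by omega)]

theorem maxCost_eq_zero {n : ℕ} (hn : ∀ a ∈ A, n < a) : maxCost A Q E n = 0 := by
  have : costSet A Q E n = {0} := by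
    refine Set.eq_singleton_iff_unique_mem.2 ⟨zero_mem_costSet n, ?_⟩
    rintro x ⟨l, hl, hs, rfl⟩
    cases l with
    | nil => simp
    | cons u l =>
      have := hn u (hl u (by simp))
      simp only [List.sum_cons] at hs
      omega
  rw [maxCost, this, csSup_singleton]

end

/-! ### Resonances of each level and their clusters -/

/-- The resonances of level `k`: the positive integers `w` at distance at most `1 / (8 q_k)` from
the multiples of `1 + ω`. -/
def resonances (ω : ℝ) (k : ℕ) : Set ℕ :=
  {w | 0 < w ∧ divisorDist ω w ≤ 1 / (8 * convDen ω k)}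

/-- A lower bound for the distance between clusters of resonances of level `k`. -/
def clusterGap (ω : ℝ) (k : ℕ) : ℝ := cfSum ω k * (convDen ω (k + 1) / (4 * convDen ω k))

theorem cfSum_pos {ω : ℝ} (hpos : 0 < ω) (hω : Irrational ω) (k : ℕ) : 0 < cfSum ω k := by
  have h1 := one_le_convDen hω k
  have h2 := convDen_le_cfSum hpos hω k
  exact_mod_cast (zero_lt_one.trans_le (h1.trans h2))

theorem clusterGap_pos {ω : ℝ} (hpos : 0 < ω) (hω : Irrational ω) (k : ℕ) :
    0 < clusterGap ω k := by
  have h1 := one_le_convDen hω k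
  have h2 := one_le_convDen hω (k + 1)
  have h3 := cfSum_pos hpos hω k
  unfold clusterGap
  positivity

/-- Reducing `b` modulo `W_k` subtracts fewer than `q_{k+1} / (4 q_k)` copies of `W_k`, each costing
at most `1 / q_{k+1}`. The remainder is then closer than `1 / (2 q_k)`, which `divisorDist_ge`
allows only for remainder 0. -/
theorem cfSum_dvd {ω : ℝ} (hpos : 0 < ω) (hω : Irrational ω) (k : ℕ) {b : ℕ}
    (hb : divisorDist ω b ≤ 1 / (4 * convDen ω k)) (hlt : (b : ℝ) < clusterGap ω k) :
    cfSum ω k ∣ b := by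
  have q1 := one_le_convDen hω k
  have q2 := one_le_convDen hω (k + 1)
  have hW := cfSum_pos hpos hω k
  by_contra hnd
  have hr0 : 0 < b % cfSum ω k := Nat.pos_of_ne_zero fun h => hnd (Nat.dvd_of_mod_eq_zero h)
  have hr1 : b % cfSum ω k < cfSum ω k := Nat.mod_lt _ hW
  have h1 := divisorDist_ge hpos hω k (r := (b % cfSum ω k : ℕ)) (by exact_mod_cast hr0)
    (by exact_mod_cast hr1)
  have hdecomp : ((b % cfSum ω k : ℕ) : ℤ) = b + -((b / cfSum ω k : ℕ) * (cfSum ω k : ℤ)) := by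
    have : (cfSum ω k : ℤ) * (b / cfSum ω k : ℕ) + (b % cfSum ω k : ℕ) = b := by
      exact_mod_cast Nat.div_add_mod b (cfSum ω k)
    linarith
  have h2 : divisorDist ω (b % cfSum ω k : ℕ) ≤
      divisorDist ω b + (b / cfSum ω k : ℕ) * divisorDist ω (cfSum ω k) := by
    rw [hdecomp]
    refine (divisorDist_add_le _ _ _).trans ?_
    rw [divisorDist_neg]
    gcongr
    exact divisorDist_natCast_mul_le _ _ _
  have h3 : ((b / cfSum ω k : ℕ) : ℝ) < convDen ω (k + 1) / (4 * convDen ω k) := by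
    have hW' : (0 : ℝ) < cfSum ω k := by exact_mod_cast hW
    have := Nat.cast_div_le (α := ℝ) (m := b) (n := cfSum ω k)
    refine this.trans_lt ?_
    rw [div_lt_iff₀ hW', mul_comm]
    exact hlt
  have h4 : ((b / cfSum ω k : ℕ) : ℝ) * divisorDist ω (cfSum ω k) < 1 / (4 * convDen ω k) := by
    calc ((b / cfSum ω k : ℕ) : ℝ) * divisorDist ω (cfSum ω k)
        ≤ (b / cfSum ω k : ℕ) * (1 / convDen ω (k + 1)) := by
          gcongr; exact divisorDist_cfSum_le hpos hω k
      _ < convDen ω (k + 1) / (4 * convDen ω k) * (1 / convDen ω (k + 1)) := by gcongr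
      _ = 1 / (4 * convDen ω k) := by field_simp
  have e : 1 / (2 * convDen ω k) = 1 / (4 * convDen ω k) + 1 / (4 * convDen ω k) := by
    field_simp; norm_num
  linarith

theorem isClustered_resonances {ω : ℝ} (hpos : 0 < ω) (hω : Irrational ω) (k : ℕ) :
    IsClustered (resonances ω k) (cfSum ω k) (clusterGap ω k) where
  pos := cfSum_pos hpos hω k
  posE := clusterGap_pos hpos hω k
  dvd := by
    intro a ha hlt
    refine cfSum_dvd hpos hω k (ha.2.trans ?_) hlt
    have q1 := one_le_convDen hω k
    gcongr
    norm_num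
  dvd_sub := by
    intro a ha b hb hab hlt
    have q1 := one_le_convDen hω k
    refine cfSum_dvd hpos hω k ?_ ?_
    · have e : ((b - a : ℕ) : ℤ) = b + -a := by omega
      rw [e]
      refine (divisorDist_add_le _ _ _).trans ?_
      rw [divisorDist_neg]
      have e : 1 / (4 * convDen ω k) = 1 / (8 * convDen ω k) + 1 / (8 * convDen ω k) := by
        field_simp; norm_num
      linarith [ha.2, hb.2]
    · rw [Nat.cast_sub hab]
      linarith

theorem cfSum_le_of_mem_resonances {ω : ℝ} (hpos : 0 < ω) (hω : Irrational ω) {k w : ℕ}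
    (hw : w ∈ resonances ω k) : cfSum ω k ≤ w := by
  by_contra hlt
  have h1 := divisorDist_ge hpos hω k (r := w) (by exact_mod_cast hw.1)
    (by exact_mod_cast not_le.1 hlt)
  have q1 := one_le_convDen hω k
  have h2 : 1 / (8 * convDen ω k) < 1 / (2 * convDen ω k) := by gcongr; norm_num
  linarith [hw.2]

/-- Only finitely many levels can matter at a given `w`, so the sum defining `potential` is finite.
-/
theorem succ_le_cfSum {ω : ℝ} (hpos : 0 < ω) (hω : Irrational ω) (k : ℕ) : k + 1 ≤ cfSum ω k := by
  have hW : ∀ j, 1 ≤ cfNum ω j + cfDen ω j := by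
    intro j
    cases j with
    | zero => simp [cfNum, cfDen, contSeq]
    | succ j =>
      have := cfNum_nonneg hpos hω (j + 1)
      have := one_le_cfDen_succ hω j
      omega
  induction k with
  | zero => exact cfSum_pos hpos hω 0
  | succ k ih =>
    have h1 := cfSum_cast hpos hω k
    have h2 := cfSum_cast hpos hω (k + 1)
    have h3 := hW k
    have h4 := hW (k + 1)
    have h5 := one_le_floor_completeQuot hω k
    have e1 : cfDen ω (k + 2) =
        ⌊completeQuot ω (k + 1)⌋ * cfDen ω (k + 1) + cfDen ω k := rfl
    have e2 : cfNum ω (k + 2) =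
        ⌊completeQuot ω (k + 1)⌋ * cfNum ω (k + 1) + cfNum ω k := rfl
    have h6 : (cfSum ω k : ℤ) + 1 ≤ cfSum ω (k + 1) := by
      rw [h1, h2, e1, e2]
      nlinarith
    omega

/-! ### The potential and its comparison with the Bruno sum -/

/-- The contribution of the resonances of level `k` to the accumulation of small divisors. -/
def levelPotential (ω : ℝ) (k w : ℕ) : ℝ :=
  maxCost (resonances ω k) (cfSum ω k) (clusterGap ω k) w * Real.log (8 * convDen ω (k + 1))

/-- A bound for the logarithm of the largest product of inverse divisors which occurs in the
coefficients of degree `w + 1` of the linearization. -/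
def potential (ω : ℝ) (w : ℕ) : ℝ :=
  w * Real.log 8 + ∑ k ∈ Finset.range (w + 1), levelPotential ω k w

section

variable {ω : ℝ}

theorem log_eight_mul_convDen_nonneg (hω : Irrational ω) (k : ℕ) :
    0 ≤ Real.log (8 * convDen ω k) :=
  Real.log_nonneg (by linarith [one_le_convDen hω k])

theorem levelPotential_nonneg (hpos : 0 < ω) (hω : Irrational ω) (k w : ℕ) :
    0 ≤ levelPotential ω k w :=
  mul_nonneg (maxCost_nonneg (clusterGap_pos hpos hω k) w) (log_eight_mul_convDen_nonneg hω _)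

theorem levelPotential_add_le (hpos : 0 < ω) (hω : Irrational ω) (k v w : ℕ) :
    levelPotential ω k v + levelPotential ω k w ≤ levelPotential ω k (v + w) := by
  unfold levelPotential
  rw [← add_mul]
  exact mul_le_mul_of_nonneg_right (maxCost_add_le (clusterGap_pos hpos hω k) v w)
    (log_eight_mul_convDen_nonneg hω _)

theorem levelPotential_le_succ (hpos : 0 < ω) (hω : Irrational ω) (k w : ℕ) :
    levelPotential ω k w ≤ levelPotential ω k (w + 1) := by
  linarith [levelPotential_add_le hpos hω k w 1, levelPotential_nonneg hpos hω k 1]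

theorem levelPotential_eq_zero (hpos : 0 < ω) (hω : Irrational ω) {k w : ℕ} (h : w < cfSum ω k) :
    levelPotential ω k w = 0 := by
  rw [levelPotential, maxCost_eq_zero, zero_mul]
  exact fun a ha => h.trans_le (cfSum_le_of_mem_resonances hpos hω ha)

theorem sum_range_levelPotential (hpos : 0 < ω) (hω : Irrational ω) {m n w : ℕ} (hmn : m ≤ n)
    (hm : ∀ k, m ≤ k → w < cfSum ω k) :
    ∑ k ∈ Finset.range n, levelPotential ω k w = ∑ k ∈ Finset.range m, levelPotential ω k w := by
  refine (Finset.sum_subset (Finset.range_mono hmn) fun k _ hk => ?_).symm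
  exact levelPotential_eq_zero hpos hω (hm k (by simpa using hk))

theorem potential_eq (hpos : 0 < ω) (hω : Irrational ω) {w n : ℕ} (hn : w + 1 ≤ n) :
    potential ω w = w * Real.log 8 + ∑ k ∈ Finset.range n, levelPotential ω k w := by
  rw [potential, sum_range_levelPotential hpos hω hn]
  intro k hk
  have := succ_le_cfSum hpos hω k
  omega

theorem potential_add_le (hpos : 0 < ω) (hω : Irrational ω) (v w : ℕ) :
    potential ω v + potential ω w ≤ potential ω (v + w) := by
  rw [potential_eq hpos hω (n := v + w + 1) (w := v) (by omega),
    potential_eq hpos hω (n := v + w + 1) (w := w) (by omega), potential]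
  have := Finset.sum_le_sum fun k (_ : k ∈ Finset.range (v + w + 1)) =>
    levelPotential_add_le hpos hω k v w
  rw [Finset.sum_add_distrib] at this
  push_cast
  linarith

theorem potential_nonneg (hpos : 0 < ω) (hω : Irrational ω) (w : ℕ) : 0 ≤ potential ω w :=
  add_nonneg (mul_nonneg (Nat.cast_nonneg _) (Real.log_nonneg (by norm_num)))
    (Finset.sum_nonneg fun _ _ => levelPotential_nonneg hpos hω _ _)

theorem potential_le_succ (hpos : 0 < ω) (hω : Irrational ω) (w : ℕ) :
    potential ω w ≤ potential ω (w + 1) := by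
  linarith [potential_add_le hpos hω w 1, potential_nonneg hpos hω 1]

/-- If `w + 1` is resonant at level `j` but not at `j + 1`, its divisor exceeds `1 / (8 q_{j+1})`
and the jump of level `j` pays for it. If it is not resonant at level 0, the divisor exceeds `1 / 8`
and the linear term pays. -/
theorem log_le_potential_sub (hpos : 0 < ω) (hω : Irrational ω) (w : ℕ) :
    potential ω w - Real.log (divisorDist ω (w + 1 : ℕ)) ≤ potential ω (w + 1) := by
  have hd : 0 < divisorDist ω (w + 1 : ℕ) := divisorDist_pos hω (by omega)
  have key : ∀ k, w + 1 ∉ resonances ω k →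
      -Real.log (divisorDist ω (w + 1 : ℕ)) ≤ Real.log (8 * convDen ω k) := by
    intro k hk
    have hlt : 1 / (8 * convDen ω k) < divisorDist ω (w + 1 : ℕ) := by
      by_contra hle
      exact hk ⟨Nat.succ_pos w, not_lt.1 hle⟩
    have hq := one_le_convDen hω k
    have := Real.log_le_log (by positivity) hlt.le
    rw [one_div, Real.log_inv] at this
    linarith
  rw [potential_eq hpos hω (n := w + 1 + 1) (w := w) (by omega), potential]
  have hmono := fun k => levelPotential_le_succ hpos hω k w
  push_cast
  by_cases h0 : w + 1 ∈ resonances ω 0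
  · obtain ⟨j, hj, hj'⟩ : ∃ j, w + 1 ∈ resonances ω j ∧ w + 1 ∉ resonances ω (j + 1) := by
      -- No integer is resonant at all levels, because a resonance of level `k` is at least `W_k ≥ k
      -- + 1`.
      by_contra hcon
      push Not at hcon
      have hall : ∀ j, w + 1 ∈ resonances ω j := fun j => Nat.rec h0 (fun j ih => hcon j ih) j
      have h1 := cfSum_le_of_mem_resonances hpos hω (hall (w + 1))
      have h2 := succ_le_cfSum hpos hω (w + 1)
      omega
    have hjw : j ∈ Finset.range (w + 1 + 1) := by
      have h1 := cfSum_le_of_mem_resonances hpos hω hj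
      have h2 := succ_le_cfSum hpos hω j
      rw [Finset.mem_range]
      omega
    have h3 := Finset.single_le_sum (f := fun k => levelPotential ω k (w + 1) -
      levelPotential ω k w) (fun k _ => sub_nonneg.2 (hmono k)) hjw
    rw [Finset.sum_sub_distrib] at h3
    have h4 : Real.log (8 * convDen ω (j + 1)) ≤
        levelPotential ω j (w + 1) - levelPotential ω j w := by
      have h5 := maxCost_add_one_le (isClustered_resonances hpos hω j) hj
      have h6 := log_eight_mul_convDen_nonneg hω (j + 1)
      unfold levelPotential
      nlinarith
    have h7 := key (j + 1) hj'
    have h8 : 0 ≤ Real.log (8 : ℝ) := Real.log_nonneg (by norm_num)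
    push_cast at *
    linarith
  · have h1 := key 0 h0
    have h2 : convDen ω 0 = 1 := GenContFract.zeroth_den_eq_one
    rw [h2, mul_one] at h1
    have h3 := Finset.sum_le_sum fun k (_ : k ∈ Finset.range (w + 1 + 1)) => hmono k
    push_cast at *
    linarith

theorem convDen_mono (ω : ℝ) : Monotone (convDen ω) :=
  monotone_nat_of_le_succ fun _ => GenContFract.of_den_mono

theorem log_le_two_mul_sqrt {x : ℝ} (hx : 0 < x) : Real.log x ≤ 2 * Real.sqrt x := by
  have h1 := Real.log_le_sub_one_of_pos (Real.sqrt_pos.2 hx)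
  rw [Real.log_sqrt hx.le] at h1
  linarith

/-- The error term of level `k` in the comparison with the Bruno sum. -/
def brunoError (ω : ℝ) (k : ℕ) : ℝ :=
  Real.log 8 / convDen ω k + 8 * (Real.log (8 * convDen ω (k + 1)) / convDen ω (k + 1))

theorem brunoError_nonneg (hω : Irrational ω) (k : ℕ) : 0 ≤ brunoError ω k := by
  have h1 := one_le_convDen hω k
  have h2 := one_le_convDen hω (k + 1)
  have h3 := log_eight_mul_convDen_nonneg hω (k + 1)
  have h4 : 0 ≤ Real.log (8 : ℝ) := Real.log_nonneg (by norm_num)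
  unfold brunoError
  positivity

/-- The denominators grow at least like `(3/2)^k`, and `log x ≤ 2 √x` handles the logarithm. -/
theorem summable_brunoError (hω : Irrational ω) : Summable (brunoError ω) := by
  have hgeom : Summable fun k : ℕ => (2 / 3 : ℝ) ^ k :=
    summable_geometric_of_lt_one (by norm_num) (by norm_num)
  have hgeom' : Summable fun k : ℕ => 6 * Real.sqrt (2 / 3) ^ k :=
    (summable_geometric_of_lt_one (Real.sqrt_nonneg _)
      (by rw [Real.sqrt_lt' one_pos]; norm_num)).mul_left 6
  have hlow : ∀ k, (convDen ω (k + 1))⁻¹ ≤ (2 / 3) ^ k := by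
    intro k
    have e : (2 / 3 : ℝ) ^ k = ((3 / 2 : ℝ) ^ k)⁻¹ := by rw [← inv_pow]; norm_num
    rw [e]
    exact inv_anti₀ (by positivity) (three_halves_pow_le_convDen hω k)
  refine Summable.add ?_ (Summable.mul_left 8 ?_)
  · simp only [div_eq_mul_inv]
    refine Summable.mul_left _ ((summable_nat_add_iff 1).1 ?_)
    refine Summable.of_nonneg_of_le (fun k => ?_) hlow hgeom
    have := one_le_convDen hω (k + 1)
    positivity
  · refine Summable.of_nonneg_of_le (fun k => ?_) (fun k => ?_) hgeom'
    · have := one_le_convDen hω (k + 1)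
      exact div_nonneg (log_eight_mul_convDen_nonneg hω _) (by positivity)
    · have hq := one_le_convDen hω (k + 1)
      have hs : 0 < Real.sqrt (convDen ω (k + 1)) := Real.sqrt_pos.2 (by positivity)
      have h1 := log_le_two_mul_sqrt (x := 8 * convDen ω (k + 1)) (by positivity)
      rw [Real.sqrt_mul (by norm_num)] at h1
      have h8 : Real.sqrt 8 ≤ 3 := by rw [Real.sqrt_le_left (by norm_num)]; norm_num
      have h2 : Real.log (8 * convDen ω (k + 1)) ≤ 6 * Real.sqrt (convDen ω (k + 1)) := by
        nlinarith
      have h3 : (Real.sqrt (convDen ω (k + 1)))⁻¹ ≤ Real.sqrt (2 / 3) ^ k := by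
        rw [← Real.sqrt_inv, Real.sqrt_le_left (by positivity), ← pow_mul, mul_comm k 2, pow_mul,
          Real.sq_sqrt (by norm_num)]
        exact hlow k
      calc Real.log (8 * convDen ω (k + 1)) / convDen ω (k + 1)
          ≤ 6 * Real.sqrt (convDen ω (k + 1)) / convDen ω (k + 1) := by gcongr
        _ = 6 * (Real.sqrt (convDen ω (k + 1)))⁻¹ := by
          rw [mul_div_assoc, Real.sqrt_div_self]
        _ ≤ 6 * Real.sqrt (2 / 3) ^ k := by gcongr

theorem levelPotential_le (hpos : 0 < ω) (hω : Irrational ω) (k w : ℕ) :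
    levelPotential ω k w ≤
      w * (Real.log (convDen ω (k + 1)) / convDen ω k + brunoError ω k) := by
  have q0 := one_le_convDen hω k
  have q1 := one_le_convDen hω (k + 1)
  have hW := convDen_le_cfSum hpos hω k
  have hgap : convDen ω (k + 1) / 4 ≤ clusterGap ω k := by
    unfold clusterGap
    calc convDen ω (k + 1) / 4
        = convDen ω k * (convDen ω (k + 1) / (4 * convDen ω k)) := by field_simp
      _ ≤ _ := by gcongr
  have hcost : maxCost (resonances ω k) (cfSum ω k) (clusterGap ω k) w ≤
      w / convDen ω k + 8 * w / convDen ω (k + 1) := by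
    have hE := clusterGap_pos hpos hω k
    refine (maxCost_le hE w).trans (add_le_add (by gcongr) ((excess_le hE w).trans ?_))
    calc 2 * (w : ℝ) / clusterGap ω k ≤ 2 * w / (convDen ω (k + 1) / 4) := by gcongr
      _ = 8 * w / convDen ω (k + 1) := by field_simp; ring
  refine (mul_le_mul_of_nonneg_right hcost (log_eight_mul_convDen_nonneg hω _)).trans_eq ?_
  rw [brunoError, Real.log_mul (by norm_num) (by positivity)]
  field_simp
  ring

/-- Levels above `κ(w + 1)` do not contribute: there `W_k ≥ q_k > w + 1`. -/
theorem potential_le (hpos : 0 < ω) (hω : Irrational ω) :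
    ∃ C : ℝ, ∀ w : ℕ, potential ω w ≤
      w * (C + ∑ m ∈ Finset.range (kappa ω (w + 1) + 1),
        Real.log (convDen ω (m + 1)) / convDen ω m) := by
  refine ⟨Real.log 8 + ∑' k, brunoError ω k, fun w => ?_⟩
  have hk : ∀ k, kappa ω (w + 1) + 1 ≤ k → w < cfSum ω k := by
    intro k hk
    have h1 := (kappa_spec hω (Nat.le_add_left 1 w)).2
    have h2 := h1.trans_le ((convDen_mono ω hk).trans (convDen_le_cfSum hpos hω k))
    have h3 : w + 1 < cfSum ω k := by exact_mod_cast h2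
    omega
  rw [potential_eq hpos hω (le_max_left (w + 1) (kappa ω (w + 1) + 1)),
    sum_range_levelPotential hpos hω (le_max_right _ _) hk]
  have h1 := Finset.sum_le_sum fun k (_ : k ∈ Finset.range (kappa ω (w + 1) + 1)) =>
    levelPotential_le hpos hω k w
  rw [← Finset.mul_sum, Finset.sum_add_distrib] at h1
  have h2 := (summable_brunoError hω).sum_le_tsum (Finset.range (kappa ω (w + 1) + 1))
    fun k _ => brunoError_nonneg hω k
  have hw : (0 : ℝ) ≤ w := Nat.cast_nonneg w
  nlinarith

end

/-! ### One-variable majorants -/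

theorem sum_range_antidiagonal_le (f : ℕ × ℕ → ℝ) (hf : ∀ p, 0 ≤ f p) (N : ℕ) :
    ∑ k ∈ Finset.range N, ∑ p ∈ Finset.HasAntidiagonal.antidiagonal k, f p ≤
      ∑ i ∈ Finset.range N, ∑ j ∈ Finset.range N, f (i, j) := by
  rw [← Finset.sum_product', ← Finset.sum_biUnion]
  · refine Finset.sum_le_sum_of_subset_of_nonneg ?_ fun p _ _ => hf p
    intro p hp
    simp only [Finset.mem_biUnion, Finset.mem_range, Finset.HasAntidiagonal.mem_antidiagonal,
      Finset.mem_product] at *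
    obtain ⟨k, hk, h⟩ := hp
    omega
  · intro a _ b _ hab
    rw [Function.onFun, Finset.disjoint_left]
    intro p hp hp'
    rw [Finset.HasAntidiagonal.mem_antidiagonal] at hp hp'
    exact hab (hp.symm.trans hp')

/-- The partial sums of a power series. -/
def partialSum (X : PowerSeries ℝ) (t : ℝ) (N : ℕ) : ℝ :=
  ∑ k ∈ Finset.range N, PowerSeries.coeff k X * t ^ k

theorem coeff_mul_nonneg {X Y : PowerSeries ℝ} (hX : ∀ k, 0 ≤ PowerSeries.coeff k X)
    (hY : ∀ k, 0 ≤ PowerSeries.coeff k Y) (k : ℕ) : 0 ≤ PowerSeries.coeff k (X * Y) := by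
  rw [PowerSeries.coeff_mul]
  exact Finset.sum_nonneg fun p _ => mul_nonneg (hX _) (hY _)

theorem coeff_pow_nonneg {X : PowerSeries ℝ} (hX : ∀ k, 0 ≤ PowerSeries.coeff k X) (m k : ℕ) :
    0 ≤ PowerSeries.coeff k (X ^ m) := by
  induction m generalizing k with
  | zero =>
    rw [pow_zero, PowerSeries.coeff_one]
    split_ifs <;> norm_num
  | succ m ih =>
    rw [pow_succ]
    exact coeff_mul_nonneg ih hX k

theorem partialSum_nonneg {X : PowerSeries ℝ} (hX : ∀ k, 0 ≤ PowerSeries.coeff k X) {t : ℝ}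
    (ht : 0 ≤ t) (N : ℕ) : 0 ≤ partialSum X t N :=
  Finset.sum_nonneg fun k _ => mul_nonneg (hX k) (pow_nonneg ht k)

theorem partialSum_mul_le {X Y : PowerSeries ℝ} (hX : ∀ k, 0 ≤ PowerSeries.coeff k X)
    (hY : ∀ k, 0 ≤ PowerSeries.coeff k Y) {t : ℝ} (ht : 0 ≤ t) (N : ℕ) :
    partialSum (X * Y) t N ≤ partialSum X t N * partialSum Y t N := by
  unfold partialSum
  rw [Finset.sum_mul_sum]
  refine le_trans (le_of_eq ?_) (sum_range_antidiagonal_le (fun p : ℕ × ℕ =>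
    PowerSeries.coeff p.1 X * t ^ p.1 * (PowerSeries.coeff p.2 Y * t ^ p.2))
    (fun p => mul_nonneg (mul_nonneg (hX _) (pow_nonneg ht _))
      (mul_nonneg (hY _) (pow_nonneg ht _))) N)
  refine Finset.sum_congr rfl fun k _ => ?_
  rw [PowerSeries.coeff_mul, Finset.sum_mul]
  refine Finset.sum_congr rfl fun p hp => ?_
  rw [← Finset.HasAntidiagonal.mem_antidiagonal.1 hp, pow_add]
  ring

theorem partialSum_pow_le {X : PowerSeries ℝ} (hX : ∀ k, 0 ≤ PowerSeries.coeff k X) {t : ℝ}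
    (ht : 0 ≤ t) (N m : ℕ) : partialSum (X ^ (m + 1)) t N ≤ partialSum X t N ^ (m + 1) := by
  induction m with
  | zero => simp
  | succ m ih =>
    rw [pow_succ, pow_succ _ (m + 1)]
    exact (partialSum_mul_le (coeff_pow_nonneg hX _) hX ht N).trans
      (mul_le_mul_of_nonneg_right ih (partialSum_nonneg hX ht N))

/-- Supermultiplicativity collects the weights of all factors of a product into the single weight `R
k`. -/
theorem coeff_pow_le_mul {s R : ℕ → ℝ} (hs : ∀ k, 0 ≤ s k) (hR : ∀ k, 0 < R k)
    (hmul : ∀ k l, R k * R l ≤ R (k + l)) (m k : ℕ) :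
    PowerSeries.coeff k (PowerSeries.mk s ^ (m + 1)) ≤
      R k * PowerSeries.coeff k (PowerSeries.mk (fun j => s j / R j) ^ (m + 1)) := by
  have hx : ∀ j, 0 ≤ PowerSeries.coeff j (PowerSeries.mk (fun j => s j / R j)) := fun j => by
    rw [PowerSeries.coeff_mk]
    exact div_nonneg (hs j) (hR j).le
  induction m generalizing k with
  | zero => simp [mul_div_cancel₀ _ (hR k).ne']
  | succ m ih =>
    rw [pow_succ, pow_succ _ (m + 1), PowerSeries.coeff_mul, PowerSeries.coeff_mul, Finset.mul_sum]
    refine Finset.sum_le_sum fun p hp => ?_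
    have h1 := ih p.1
    have h2 : PowerSeries.coeff p.2 (PowerSeries.mk s) =
        R p.2 * PowerSeries.coeff p.2 (PowerSeries.mk (fun j => s j / R j)) := by
      rw [PowerSeries.coeff_mk, PowerSeries.coeff_mk, mul_div_cancel₀ _ (hR _).ne']
    have h3 := hmul p.1 p.2
    rw [Finset.HasAntidiagonal.mem_antidiagonal.1 hp] at h3
    have h4 := hx p.2
    have h5 := coeff_pow_nonneg hx (m + 1) p.1
    rw [h2]
    calc _ ≤ (R p.1 * PowerSeries.coeff p.1 (PowerSeries.mk (fun j => s j / R j) ^ (m + 1))) *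
          (R p.2 * PowerSeries.coeff p.2 (PowerSeries.mk (fun j => s j / R j))) :=
          mul_le_mul_of_nonneg_right h1 (mul_nonneg (hR _).le h4)
      _ = (R p.1 * R p.2) *
          (PowerSeries.coeff p.1 (PowerSeries.mk (fun j => s j / R j) ^ (m + 1)) *
            PowerSeries.coeff p.2 (PowerSeries.mk (fun j => s j / R j))) := by ring
      _ ≤ _ := mul_le_mul_of_nonneg_right h3 (mul_nonneg h5 h4)

/-- Sequences satisfying the recursive inequality of the method of majorants grow at most
geometrically. -/
theorem geometric_bound_of_recursive {x : ℕ → ℝ} (hx : ∀ k, 0 ≤ x k) {A B : ℝ} (hA : 0 < A)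
    (hB : 0 < B)
    (hrec : ∀ v, x (v + 1) ≤ ∑ p ∈ Finset.HasAntidiagonal.antidiagonal v,
      A * B ^ (p.1 + 2) * PowerSeries.coeff p.2 (PowerSeries.mk x ^ (p.1 + 2))) :
    ∃ A' B' : ℝ, 0 < A' ∧ 0 < B' ∧ ∀ k, x k ≤ A' * B' ^ k := by
  obtain ⟨c, hc, hxc⟩ : ∃ c : ℝ, 0 < c ∧ x 0 ≤ c := ⟨x 0 + 1, by linarith [hx 0], by linarith⟩
  -- This choice gives `4Bct ≤ 1`, hence `y ≤ 1/2` and a convergent geometric series, and `8AB²ct ≤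
  -- 1`, so the nonlinear term stays below `c` as long as the partial sums stay below `2c`.
  obtain ⟨t, ht, htc⟩ : ∃ t : ℝ, 0 < t ∧ t * (8 * A * B ^ 2 * c + 4 * B * c) = 1 :=
    ⟨1 / (8 * A * B ^ 2 * c + 4 * B * c), by positivity, by field_simp⟩
  have hX : ∀ k, 0 ≤ PowerSeries.coeff k (PowerSeries.mk x) := fun k => by
    rw [PowerSeries.coeff_mk]; exact hx k
  obtain ⟨y, hy⟩ : ∃ y, y = 2 * B * c * t := ⟨_, rfl⟩
  have hy0 : 0 ≤ y := by rw [hy]; positivity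
  have hAc : 0 < A * B ^ 2 * c * t := by positivity
  have hBc : 0 < B * c * t := by positivity
  have hy1 : y ≤ 1 / 2 := by rw [hy]; nlinarith
  have main : ∀ N, partialSum (PowerSeries.mk x) t N ≤ 2 * c := by
    intro N
    induction N with
    | zero => simp [partialSum, hc.le]
    | succ N ih =>
      have hT := partialSum_nonneg hX ht.le N
      have hgeom : ∑ i ∈ Finset.range N, y ^ (i + 1) ≤ 2 * y := by
        simp_rw [pow_succ', ← Finset.mul_sum]
        rw [mul_comm 2 y]
        refine mul_le_mul_of_nonneg_left ?_ hy0
        exact (Finset.sum_le_sum fun i _ => pow_le_pow_left₀ hy0 hy1 i).trans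
          (sum_geometric_two_le N)
      have hstep : ∑ v ∈ Finset.range N, x (v + 1) * t ^ (v + 1) ≤
          A * (2 * B * c) * ∑ i ∈ Finset.range N, y ^ (i + 1) := by
        calc ∑ v ∈ Finset.range N, x (v + 1) * t ^ (v + 1)
            ≤ ∑ v ∈ Finset.range N, ∑ p ∈ Finset.HasAntidiagonal.antidiagonal v,
                A * B ^ (p.1 + 2) * t ^ (p.1 + 1) *
                  (PowerSeries.coeff p.2 (PowerSeries.mk x ^ (p.1 + 2)) * t ^ p.2) := by
              refine Finset.sum_le_sum fun v _ => ?_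
              refine (mul_le_mul_of_nonneg_right (hrec v) (by positivity)).trans_eq ?_
              rw [Finset.sum_mul]
              refine Finset.sum_congr rfl fun p hp => ?_
              rw [← Finset.HasAntidiagonal.mem_antidiagonal.1 hp]
              ring
          _ ≤ ∑ i ∈ Finset.range N, ∑ j ∈ Finset.range N, A * B ^ (i + 2) * t ^ (i + 1) *
                  (PowerSeries.coeff j (PowerSeries.mk x ^ (i + 2)) * t ^ j) :=
              sum_range_antidiagonal_le (fun p => A * B ^ (p.1 + 2) * t ^ (p.1 + 1) *
                  (PowerSeries.coeff p.2 (PowerSeries.mk x ^ (p.1 + 2)) * t ^ p.2))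
                (fun p => mul_nonneg (by positivity)
                  (mul_nonneg (coeff_pow_nonneg hX _ _) (by positivity))) N
          _ ≤ ∑ i ∈ Finset.range N, A * B ^ (i + 2) * t ^ (i + 1) * (2 * c) ^ (i + 2) := by
              refine Finset.sum_le_sum fun i _ => ?_
              rw [← Finset.mul_sum]
              refine mul_le_mul_of_nonneg_left ?_ (by positivity)
              exact (partialSum_pow_le hX ht.le N (i + 1)).trans (pow_le_pow_left₀ hT ih _)
          _ = _ := by
              rw [Finset.mul_sum]
              refine Finset.sum_congr rfl fun i _ => ?_
              rw [hy]
              ring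
      have h1 : partialSum (PowerSeries.mk x) t (N + 1) =
          ∑ v ∈ Finset.range N, x (v + 1) * t ^ (v + 1) + x 0 := by
        simp [partialSum, Finset.sum_range_succ']
      have h2 : A * (2 * B * c) * ∑ i ∈ Finset.range N, y ^ (i + 1) ≤ A * (2 * B * c) * (2 * y) :=
        mul_le_mul_of_nonneg_left hgeom (by positivity)
      have h3 : A * (2 * B * c) * (2 * y) ≤ c := by
        have e : A * (2 * B * c) * (2 * y) = (8 * (A * B ^ 2 * c * t)) * c := by rw [hy]; ring
        rw [e]
        refine mul_le_of_le_one_left hc.le ?_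
        nlinarith
      rw [h1]
      linarith
  refine ⟨2 * c, t⁻¹, by positivity, by positivity, fun k => ?_⟩
  have h1 := Finset.single_le_sum (f := fun j => PowerSeries.coeff j (PowerSeries.mk x) * t ^ j)
    (fun j _ => mul_nonneg (hX j) (by positivity)) (Finset.self_mem_range_succ k)
  have h2 := h1.trans (main (k + 1))
  simp only [PowerSeries.coeff_mk] at h2
  rw [inv_pow, ← div_eq_mul_inv, le_div_iff₀ (by positivity)]
  exact h2

/-- The method of majorants with small divisors `d` and weights `P`: the accumulation of small
divisors is controlled by any superadditive potential `K` whose increments bound `-log d`. -/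
theorem weighted_bound_of_recursive {s P K d φ : ℕ → ℝ} (hs : ∀ k, 0 ≤ s k)
    (hP : ∀ k, 0 < P k) (hPmul : ∀ k l, P k * P l ≤ P (k + l))
    (hK : ∀ k l, K k + K l ≤ K (k + l)) (hKmono : Monotone K) (hd : ∀ k, 0 < d (k + 1))
    (hKd : ∀ k, K k - Real.log (d (k + 1)) ≤ K (k + 1)) {A B : ℝ} (hA : 0 < A)
    (hB : 0 < B) (hφ : ∀ i, φ (i + 2) ≤ A * B ^ (i + 2) * P (i + 1))
    (hrec : ∀ v, d (v + 1) * s (v + 1) ≤ ∑ p ∈ Finset.HasAntidiagonal.antidiagonal v,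
      φ (p.1 + 2) * PowerSeries.coeff p.2 (PowerSeries.mk s ^ (p.1 + 2))) :
    ∃ A' B' : ℝ, 0 < A' ∧ 0 < B' ∧ ∀ k, s k ≤ A' * B' ^ k * (P k * Real.exp (K k)) := by
  have hR : ∀ k, 0 < P k * Real.exp (K k) := fun k => mul_pos (hP k) (Real.exp_pos _)
  have hRmul : ∀ k l, P k * Real.exp (K k) * (P l * Real.exp (K l)) ≤
      P (k + l) * Real.exp (K (k + l)) := by
    intro k l
    calc P k * Real.exp (K k) * (P l * Real.exp (K l))
        = (P k * P l) * Real.exp (K k + K l) := by rw [Real.exp_add]; ring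
      _ ≤ _ := mul_le_mul (hPmul k l) (Real.exp_le_exp.2 (hK k l)) (Real.exp_pos _).le (hP _).le
  obtain ⟨x, hxdef⟩ : ∃ x : ℕ → ℝ, x = fun j => s j / (P j * Real.exp (K j)) := ⟨_, rfl⟩
  have hx : ∀ k, 0 ≤ x k := fun k => by rw [hxdef]; exact div_nonneg (hs k) (hR k).le
  have hX : ∀ k, 0 ≤ PowerSeries.coeff k (PowerSeries.mk x) := fun k => by
    rw [PowerSeries.coeff_mk]; exact hx k
  have hsx : ∀ k, s k = P k * Real.exp (K k) * x k := fun k => by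
    rw [hxdef]; exact (mul_div_cancel₀ _ (hR k).ne').symm
  obtain ⟨A', B', hA', hB', h⟩ := geometric_bound_of_recursive hx hA hB (fun v => by
    have hexp : Real.exp (K v) ≤ Real.exp (K (v + 1)) * d (v + 1) := by
      have h1 := Real.exp_le_exp.2 (hKd v)
      rw [Real.exp_sub, Real.exp_log (hd v), div_le_iff₀ (hd v)] at h1
      exact h1
    have h1 : d (v + 1) * s (v + 1) ≤ (P (v + 1) * Real.exp (K v)) *
        ∑ p ∈ Finset.HasAntidiagonal.antidiagonal v,
          A * B ^ (p.1 + 2) * PowerSeries.coeff p.2 (PowerSeries.mk x ^ (p.1 + 2)) := by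
      refine (hrec v).trans ?_
      rw [Finset.mul_sum]
      refine Finset.sum_le_sum fun p hp => ?_
      have hpv := Finset.HasAntidiagonal.mem_antidiagonal.1 hp
      have hS : ∀ k, 0 ≤ PowerSeries.coeff k (PowerSeries.mk s) := fun k => by
        rw [PowerSeries.coeff_mk]; exact hs k
      have h2 := coeff_pow_le_mul hs hR hRmul (p.1 + 1) p.2
      rw [← hxdef] at h2
      have h3 := hPmul (p.1 + 1) p.2
      rw [show p.1 + 1 + p.2 = v + 1 by omega] at h3
      -- The product is only charged `K v`; the step from `K v` to `K (v + 1)` is left to pay for `d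
      -- (v + 1)`.
      have h4 : Real.exp (K p.2) ≤ Real.exp (K v) := Real.exp_le_exp.2 (hKmono (by omega))
      have h5 := coeff_pow_nonneg hX (p.1 + 2) p.2
      calc φ (p.1 + 2) * PowerSeries.coeff p.2 (PowerSeries.mk s ^ (p.1 + 2))
          ≤ (A * B ^ (p.1 + 2) * P (p.1 + 1)) * (P p.2 * Real.exp (K p.2) *
              PowerSeries.coeff p.2 (PowerSeries.mk x ^ (p.1 + 2))) :=
            mul_le_mul (hφ p.1) h2 (coeff_pow_nonneg hS _ _)
              (mul_nonneg (by positivity) (hP _).le)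
        _ = (P (p.1 + 1) * P p.2) * Real.exp (K p.2) *
              (A * B ^ (p.1 + 2) * PowerSeries.coeff p.2 (PowerSeries.mk x ^ (p.1 + 2))) := by
            ring
        _ ≤ (P (v + 1) * Real.exp (K v)) *
              (A * B ^ (p.1 + 2) * PowerSeries.coeff p.2 (PowerSeries.mk x ^ (p.1 + 2))) := by
            refine mul_le_mul_of_nonneg_right ?_ (mul_nonneg (by positivity) h5)
            exact mul_le_mul h3 h4 (Real.exp_pos _).le (hP _).le
    have hsum : 0 ≤ ∑ p ∈ Finset.HasAntidiagonal.antidiagonal v,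
        A * B ^ (p.1 + 2) * PowerSeries.coeff p.2 (PowerSeries.mk x ^ (p.1 + 2)) :=
      Finset.sum_nonneg fun p _ => mul_nonneg (by positivity) (coeff_pow_nonneg hX _ _)
    have h2 : (P (v + 1) * Real.exp (K v)) ≤ d (v + 1) * (P (v + 1) * Real.exp (K (v + 1))) := by
      calc P (v + 1) * Real.exp (K v) ≤ P (v + 1) * (Real.exp (K (v + 1)) * d (v + 1)) :=
            mul_le_mul_of_nonneg_left hexp (hP _).le
        _ = _ := by ring
    have h3 := h1.trans (mul_le_mul_of_nonneg_right h2 hsum)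
    rw [hsx (v + 1), ← mul_assoc] at h3
    exact le_of_mul_le_mul_left h3 (mul_pos (hd v) (hR _)))
  refine ⟨A', B', hA', hB', fun k => ?_⟩
  rw [hsx k, mul_comm]
  exact mul_le_mul_of_nonneg_right (h k) (hR k).le

/-! ### Formal linearization: existence and uniqueness -/

section

variable {n : ℕ}

/-- The divisor `λ·α - λ_j`. -/
def divisor (lam : Fin n → ℂ) (j : Fin n) (α : Fin n →₀ ℕ) : ℂ := ∑ i, lam i * α i - lam j

theorem coeff_X_mul_pderiv (i : Fin n) (φ : MvPowerSeries (Fin n) ℂ) (α : Fin n →₀ ℕ) :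
    MvPowerSeries.coeff α (MvPowerSeries.X i * MvPowerSeries.pderiv ℂ i φ) =
      α i * MvPowerSeries.coeff α φ := by
  rw [MvPowerSeries.X_def, MvPowerSeries.coeff_monomial_mul, one_mul]
  split_ifs with h
  · have hi : 1 ≤ α i := by simpa using h i
    rw [MvPowerSeries.coeff_pderiv, tsub_add_cancel_of_le h]
    have : (((α - Finsupp.single i 1 : Fin n →₀ ℕ) i : ℕ) : ℂ) + 1 = α i := by
      rw [Finsupp.tsub_apply, Finsupp.single_eq_same]
      push_cast [hi]
      ring
    rw [this, mul_comm]
  · have hi : α i = 0 := by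
      by_contra h0
      exact h (Finsupp.single_le_iff.2 (Nat.one_le_iff_ne_zero.2 h0))
    simp [hi]

theorem coeff_linearField_derivative (lam : Fin n → ℂ) (φ : MvPowerSeries (Fin n) ℂ)
    (α : Fin n →₀ ℕ) :
    MvPowerSeries.coeff α (∑ i, linearField lam i * MvPowerSeries.pderiv ℂ i φ) =
      (∑ i, lam i * α i) * MvPowerSeries.coeff α φ := by
  rw [map_sum, Finset.sum_mul]
  refine Finset.sum_congr rfl fun i _ => ?_
  rw [linearField, mul_assoc, MvPowerSeries.coeff_C_mul, coeff_X_mul_pderiv, mul_assoc]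

theorem subst_linearField (lam : Fin n → ℂ) {h : VSeries n} (hh : h ∈ V n 1) (j : Fin n) :
    MvPowerSeries.subst (changeVar h) (linearField lam j) =
      MvPowerSeries.C (lam j) * changeVar h j := by
  rw [linearField, MvPowerSeries.subst_mul (hasSubst_changeVar hh),
    MvPowerSeries.subst_X (hasSubst_changeVar hh), MvPowerSeries.subst_C]

theorem coeff_changeVar_of_two_le (h : VSeries n) (j : Fin n) {α : Fin n →₀ ℕ}
    (hα : 2 ≤ α.degree) :
    MvPowerSeries.coeff α (changeVar h j) = MvPowerSeries.coeff α (h j) := by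
  rw [changeVar, map_add, MvPowerSeries.coeff_X, if_neg, zero_add]
  rintro rfl
  rw [Finsupp.degree_single] at hα
  omega

theorem divisor_mul_coeff_X (lam : Fin n → ℂ) (j : Fin n) (α : Fin n →₀ ℕ) :
    divisor lam j α * MvPowerSeries.coeff α (MvPowerSeries.X j : MvPowerSeries (Fin n) ℂ) = 0 := by
  rw [MvPowerSeries.coeff_X]
  split_ifs with h
  · rw [h, divisor, Finset.sum_eq_single j]
    · simp
    · intro i _ hij
      simp [hij.symm]
    · simp
  · simp

/-- The field `A w` acts on monomials as the Euler-type operator with eigenvalue `λ·α`. Moving the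
linear part of `F` across subtracts `λ_j`, and the identity part of the change of variables drops
out since the divisor vanishes at `e_j`. -/
theorem isLinearization_iff (lam : Fin n → ℂ) (F h : VSeries n) :
    IsLinearization lam F h ↔ h ∈ V n 1 ∧ ∀ j α,
      divisor lam j α * MvPowerSeries.coeff α (h j) =
        MvPowerSeries.coeff α
          (MvPowerSeries.subst (changeVar h) ((F - linearField lam) j)) := by
  refine and_congr_right fun hh => forall_congr' fun j => ?_
  rw [MvPowerSeries.ext_iff]
  refine forall_congr' fun α => ?_
  rw [coeff_linearField_derivative, Pi.sub_apply, MvPowerSeries.subst_sub (hasSubst_changeVar hh),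
    map_sub, subst_linearField lam hh, MvPowerSeries.coeff_C_mul]
  have h1 := divisor_mul_coeff_X lam j α
  have h2 : MvPowerSeries.coeff α (changeVar h j) =
      MvPowerSeries.coeff α (MvPowerSeries.X j : MvPowerSeries (Fin n) ℂ) +
        MvPowerSeries.coeff α (h j) := by rw [changeVar, map_add]
  rw [h2]
  rw [divisor] at *
  constructor <;> intro h
  · linear_combination h - h1
  · linear_combination h + h1

/-- `φ` and `φ'` have order at least `m`, and they agree up to order `k + m`. -/
def AgreeTo (k m : ℕ) (φ φ' : MvPowerSeries (Fin n) ℂ) : Prop :=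
  (m : ℕ∞) ≤ φ.order ∧ (m : ℕ∞) ≤ φ'.order ∧ ((k + m : ℕ) : ℕ∞) ≤ (φ - φ').order

theorem AgreeTo.one (k : ℕ) : AgreeTo k 0 (1 : MvPowerSeries (Fin n) ℂ) 1 :=
  ⟨by simp, by simp, by simp⟩

theorem AgreeTo.mul {k l m : ℕ} {φ φ' ψ ψ' : MvPowerSeries (Fin n) ℂ} (h : AgreeTo k l φ φ')
    (h' : AgreeTo k m ψ ψ') : AgreeTo k (l + m) (φ * ψ) (φ' * ψ') := by
  refine ⟨?_, ?_, ?_⟩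
  · push_cast
    exact (add_le_add h.1 h'.1).trans MvPowerSeries.le_order_mul
  · push_cast
    exact (add_le_add h.2.1 h'.2.1).trans MvPowerSeries.le_order_mul
  · have e : φ * ψ - φ' * ψ' = φ * (ψ - ψ') + (φ - φ') * ψ' := by ring
    rw [e]
    refine le_trans (le_min ?_ ?_) MvPowerSeries.min_order_le_add
    · refine le_trans ?_ (le_trans (add_le_add h.1 h'.2.2) MvPowerSeries.le_order_mul)
      rw [← Nat.cast_add]
      exact Nat.cast_le.2 (by omega)
    · refine le_trans ?_ (le_trans (add_le_add h.2.2 h'.2.1) MvPowerSeries.le_order_mul)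
      rw [← Nat.cast_add]
      exact Nat.cast_le.2 (by omega)

theorem AgreeTo.pow {k : ℕ} {φ φ' : MvPowerSeries (Fin n) ℂ} (h : AgreeTo k 1 φ φ') (m : ℕ) :
    AgreeTo k m (φ ^ m) (φ' ^ m) := by
  induction m with
  | zero => simpa using AgreeTo.one k
  | succ m ih =>
    rw [pow_succ, pow_succ]
    exact ih.mul h

theorem AgreeTo.prod {k : ℕ} {H H' : VSeries n} (h : ∀ i, AgreeTo k 1 (H i) (H' i))
    (β : Fin n →₀ ℕ) :
    AgreeTo k β.degree (β.prod fun i e => H i ^ e) (β.prod fun i e => H' i ^ e) := by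
  rw [Finsupp.degree_apply, Finsupp.prod, Finsupp.prod]
  induction β.support using Finset.induction_on with
  | empty => simpa using AgreeTo.one k
  | insert a s ha ih =>
    rw [Finset.prod_insert ha, Finset.prod_insert ha, Finset.sum_insert ha]
    exact ((h a).pow _).mul ih

theorem agreeTo_changeVar {h h' : VSeries n} (hh : h ∈ V n 1) (hh' : h' ∈ V n 1) {k : ℕ}
    (heq : ∀ i (α : Fin n →₀ ℕ), α.degree ≤ k →
      MvPowerSeries.coeff α (h i) = MvPowerSeries.coeff α (h' i)) (i : Fin n) :
    AgreeTo k 1 (changeVar h i) (changeVar h' i) := by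
  have hord : ∀ g ∈ V n 1, ((1 : ℕ) : ℕ∞) ≤ (changeVar g i).order := by
    intro g hg
    refine MvPowerSeries.nat_le_order fun α hα => ?_
    have hα0 : α = 0 := by rw [← Finsupp.degree_eq_zero_iff]; omega
    have := congrFun (hg 0 (by simp)) i
    rw [hα0, changeVar, map_add, MvPowerSeries.coeff_zero_X, zero_add]
    exact this
  refine ⟨hord h hh, hord h' hh', MvPowerSeries.nat_le_order fun α hα => ?_⟩
  rw [map_sub, changeVar, changeVar, map_add, map_add, heq i α (by omega), sub_self]

/-- Replacing one factor of a monomial of degree `|β| ≥ 2` changes it only from order `k + |β| ≥ k +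
2` on. -/
theorem coeff_subst_eq_of_agree {h h' : VSeries n} (hh : h ∈ V n 1) (hh' : h' ∈ V n 1) {k : ℕ}
    (heq : ∀ i (α : Fin n →₀ ℕ), α.degree ≤ k →
      MvPowerSeries.coeff α (h i) = MvPowerSeries.coeff α (h' i))
    {f : VSeries n} (hf : f ∈ V n 1) (j : Fin n) {α : Fin n →₀ ℕ} (hα : α.degree ≤ k + 1) :
    MvPowerSeries.coeff α (MvPowerSeries.subst (changeVar h) (f j)) =
      MvPowerSeries.coeff α (MvPowerSeries.subst (changeVar h') (f j)) := by
  rw [MvPowerSeries.coeff_subst (hasSubst_changeVar hh),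
    MvPowerSeries.coeff_subst (hasSubst_changeVar hh')]
  refine finsum_congr fun β => ?_
  rcases le_or_gt β.degree 1 with hβ | hβ
  · have : MvPowerSeries.coeff β (f j) = 0 := congrFun (hf β hβ) j
    rw [this, zero_smul, zero_smul]
  · have h1 := (AgreeTo.prod (agreeTo_changeVar hh hh' heq) β).2.2
    have h2 := MvPowerSeries.coeff_of_lt_order (d := α)
      (lt_of_lt_of_le (Nat.cast_lt.2 (by omega : α.degree < k + β.degree)) h1)
    rw [map_sub, sub_eq_zero] at h2
    rw [h2]

theorem coeff_subst_eq_zero {h : VSeries n} (hh : h ∈ V n 1) {f : VSeries n} (hf : f ∈ V n 1)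
    (j : Fin n) {α : Fin n →₀ ℕ} (hα : α.degree ≤ 1) :
    MvPowerSeries.coeff α (MvPowerSeries.subst (changeVar h) (f j)) = 0 := by
  rw [MvPowerSeries.coeff_subst (hasSubst_changeVar hh)]
  refine finsum_eq_zero_of_forall_eq_zero fun β => ?_
  rcases le_or_gt β.degree 1 with hβ | hβ
  · have : MvPowerSeries.coeff β (f j) = 0 := congrFun (hf β hβ) j
    rw [this, zero_smul]
  · have h1 := (AgreeTo.prod (agreeTo_changeVar hh hh (k := 0) fun _ _ _ => rfl) β).1
    rw [MvPowerSeries.coeff_of_lt_order (lt_of_lt_of_le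
      (Nat.cast_lt.2 (by omega : α.degree < β.degree)) h1), smul_zero]

theorem IsLinearization.unique {lam : Fin n → ℂ}
    (hlam : ∀ j (α : Fin n →₀ ℕ), 2 ≤ α.degree → divisor lam j α ≠ 0) {F h h' : VSeries n}
    (hF : F - linearField lam ∈ V n 1) (hh : IsLinearization lam F h)
    (hh' : IsLinearization lam F h') : h = h' := by
  rw [isLinearization_iff] at hh hh'
  have key : ∀ k i (α : Fin n →₀ ℕ), α.degree ≤ k →
      MvPowerSeries.coeff α (h i) = MvPowerSeries.coeff α (h' i) := by
    intro k
    induction k with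
    | zero =>
      intro i α hα
      have h1 : MvPowerSeries.coeff α (h i) = 0 := congrFun (hh.1 α (by omega)) i
      have h2 : MvPowerSeries.coeff α (h' i) = 0 := congrFun (hh'.1 α (by omega)) i
      rw [h1, h2]
    | succ k ih =>
      intro i α hα
      rcases le_or_gt α.degree 1 with h1 | h1
      · have h1' : MvPowerSeries.coeff α (h i) = 0 := congrFun (hh.1 α h1) i
        have h2' : MvPowerSeries.coeff α (h' i) = 0 := congrFun (hh'.1 α h1) i
        rw [h1', h2']
      · refine mul_left_cancel₀ (hlam i α h1) ?_
        rw [hh.2 i α, hh'.2 i α]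
        exact coeff_subst_eq_of_agree hh.1 hh'.1 ih hF i hα
  funext i
  ext α
  exact key _ i α le_rfl

/-- The fixed points of this operator are the linearizations. -/
def linearizationStep (lam : Fin n → ℂ) (f g : VSeries n) : VSeries n := fun j α =>
  if α.degree ≤ 1 then 0 else
    (divisor lam j α)⁻¹ * MvPowerSeries.coeff α (MvPowerSeries.subst (changeVar g) (f j))

theorem linearizationStep_mem (lam : Fin n → ℂ) (f g : VSeries n) :
    linearizationStep lam f g ∈ V n 1 := by
  intro α hα
  funext j
  exact if_pos hα

theorem linearizationStep_agree (lam : Fin n → ℂ) {f g g' : VSeries n} (hf : f ∈ V n 1)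
    (hg : g ∈ V n 1) (hg' : g' ∈ V n 1) {k : ℕ}
    (heq : ∀ i (α : Fin n →₀ ℕ), α.degree ≤ k →
      MvPowerSeries.coeff α (g i) = MvPowerSeries.coeff α (g' i)) (i : Fin n) (α : Fin n →₀ ℕ)
    (hα : α.degree ≤ k + 1) :
    MvPowerSeries.coeff α (linearizationStep lam f g i) =
      MvPowerSeries.coeff α (linearizationStep lam f g' i) := by
  rw [MvPowerSeries.coeff_apply, MvPowerSeries.coeff_apply, linearizationStep, linearizationStep,
    coeff_subst_eq_of_agree hg hg' heq hf i hα]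

/-- Each iteration from 0 fixes one more degree, so the iterates stabilize coefficientwise; the
limit takes degree `k` from the `k`-th iterate. -/
theorem exists_linearizationStep_eq (lam : Fin n → ℂ) {f : VSeries n} (hf : f ∈ V n 1) :
    ∃ h ∈ V n 1, linearizationStep lam f h = h := by
  obtain ⟨g, hg0, hgs⟩ : ∃ g : ℕ → VSeries n, g 0 = 0 ∧
      ∀ k, g (k + 1) = linearizationStep lam f (g k) :=
    ⟨fun k => (linearizationStep lam f)^[k] 0, rfl, fun k => Function.iterate_succ_apply' _ _ _⟩
  have hg : ∀ k, g k ∈ V n 1 := by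
    intro k
    cases k with
    | zero =>
      rw [hg0]
      intro α _
      funext j
      simp [vcoeff]
    | succ k => rw [hgs]; exact linearizationStep_mem lam f _
  have hstep : ∀ k i (α : Fin n →₀ ℕ), α.degree ≤ k →
      MvPowerSeries.coeff α (g k i) = MvPowerSeries.coeff α (g (k + 1) i) := by
    intro k
    induction k with
    | zero =>
      intro i α hα
      exact (congrFun (hg 0 α (by omega)) i).trans (congrFun (hg 1 α (by omega)) i).symm
    | succ k ih =>
      intro i α hα
      rw [hgs k, hgs (k + 1)]
      exact linearizationStep_agree lam hf (hg k) (hg (k + 1)) ih i α hα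
  have hstab : ∀ k l i (α : Fin n →₀ ℕ), α.degree ≤ k →
      MvPowerSeries.coeff α (g k i) = MvPowerSeries.coeff α (g (k + l) i) := by
    intro k l i α hα
    induction l with
    | zero => rfl
    | succ l ih => rw [ih, ← add_assoc]; exact hstep _ i α (by omega)
  obtain ⟨h, hh⟩ : ∃ h : VSeries n, ∀ i (α : Fin n →₀ ℕ),
      MvPowerSeries.coeff α (h i) = MvPowerSeries.coeff α (g α.degree i) :=
    ⟨fun i α => MvPowerSeries.coeff α (g α.degree i), fun i α => rfl⟩
  have hagree : ∀ k i (α : Fin n →₀ ℕ), α.degree ≤ k →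
      MvPowerSeries.coeff α (h i) = MvPowerSeries.coeff α (g k i) := by
    intro k i α hα
    obtain ⟨l, rfl⟩ := Nat.exists_eq_add_of_le hα
    rw [hh]
    exact hstab _ l i α le_rfl
  have hV : h ∈ V n 1 := by
    intro α hα
    funext i
    exact (hh i α).trans (congrFun (hg _ α hα) i)
  refine ⟨h, hV, ?_⟩
  funext i
  ext α
  rw [linearizationStep_agree lam hf hV (hg α.degree) (hagree α.degree) i α (by omega), ← hgs,
    hagree (α.degree + 1) i α (by omega)]

theorem exists_isLinearization {lam : Fin n → ℂ}
    (hlam : ∀ j (α : Fin n →₀ ℕ), 2 ≤ α.degree → divisor lam j α ≠ 0) {F : VSeries n}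
    (hF : F - linearField lam ∈ V n 1) : ∃ h, IsLinearization lam F h := by
  obtain ⟨h, hV, hfix⟩ := exists_linearizationStep_eq lam hF
  refine ⟨h, (isLinearization_iff lam F h).2 ⟨hV, fun j α => ?_⟩⟩
  rcases le_or_gt α.degree 1 with hα | hα
  · have h1 : MvPowerSeries.coeff α (h j) = 0 := congrFun (hV α hα) j
    rw [h1, mul_zero, coeff_subst_eq_zero hV hF j hα]
  · have h1 : MvPowerSeries.coeff α (h j) = MvPowerSeries.coeff α (linearizationStep lam
      (F - linearField lam) h j) := by rw [hfix]
    rw [h1, MvPowerSeries.coeff_apply, linearizationStep, if_neg (by omega),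
      mul_inv_cancel_left₀ (hlam j α hα)]

/-! ### Degreewise norms and majorants of substitutions -/

/-- The multi-indices of total degree `k`. -/
def degreeIndices (n k : ℕ) : Finset (Fin n →₀ ℕ) := Finset.finsuppAntidiag Finset.univ k

theorem mem_degreeIndices {k : ℕ} {α : Fin n →₀ ℕ} : α ∈ degreeIndices n k ↔ α.degree = k := by
  rw [degreeIndices, Finset.mem_finsuppAntidiag, Finsupp.degree_eq_sum]
  simp

/-- Crude, but a geometric factor is harmless in the classes considered. -/
theorem card_degreeIndices_le (n k : ℕ) : (degreeIndices n k).card ≤ (2 ^ n) ^ k := by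
  have h1 : (degreeIndices n k).card ≤
      (Fintype.piFinset fun _ : Fin n => Finset.range (k + 1)).card := by
    refine Finset.card_le_card_of_injOn (fun α i => α i) ?_ ?_
    · intro α hα
      have hα' := mem_degreeIndices.1 hα
      simp only [Finset.mem_coe, Fintype.mem_piFinset, Finset.mem_range]
      intro i
      rw [Finsupp.degree_eq_sum] at hα'
      have := Finset.single_le_sum (f := fun i => α i) (fun _ _ => Nat.zero_le _)
        (Finset.mem_univ i)
      exact Nat.lt_succ_of_le (hα' ▸ this)
    · intro α _ β _ h
      ext i
      exact congrFun h i
  refine h1.trans ?_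
  rw [Fintype.card_piFinset, Finset.prod_const, Finset.card_range, Finset.card_univ,
    Fintype.card_fin, ← pow_mul, mul_comm, pow_mul]
  exact Nat.pow_le_pow_left Nat.lt_two_pow_self _

/-- The sum of the absolute values of the coefficients of total degree `k`. -/
def degNorm (φ : MvPowerSeries (Fin n) ℂ) (k : ℕ) : ℝ :=
  ∑ α ∈ degreeIndices n k, ‖MvPowerSeries.coeff α φ‖

theorem degNorm_nonneg (φ : MvPowerSeries (Fin n) ℂ) (k : ℕ) : 0 ≤ degNorm φ k :=
  Finset.sum_nonneg fun _ _ => norm_nonneg _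

theorem norm_coeff_le_degNorm (φ : MvPowerSeries (Fin n) ℂ) (α : Fin n →₀ ℕ) :
    ‖MvPowerSeries.coeff α φ‖ ≤ degNorm φ α.degree :=
  Finset.single_le_sum (f := fun α => ‖MvPowerSeries.coeff α φ‖) (fun _ _ => norm_nonneg _)
    (mem_degreeIndices.2 rfl)

theorem degNorm_mul_le (φ ψ : MvPowerSeries (Fin n) ℂ) (k : ℕ) :
    degNorm (φ * ψ) k ≤
      ∑ p ∈ Finset.HasAntidiagonal.antidiagonal k, degNorm φ p.1 * degNorm ψ p.2 := by
  unfold degNorm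
  calc ∑ α ∈ degreeIndices n k, ‖MvPowerSeries.coeff α (φ * ψ)‖
      ≤ ∑ α ∈ degreeIndices n k, ∑ q ∈ Finset.HasAntidiagonal.antidiagonal α,
          ‖MvPowerSeries.coeff q.1 φ‖ * ‖MvPowerSeries.coeff q.2 ψ‖ := by
        refine Finset.sum_le_sum fun α _ => ?_
        rw [MvPowerSeries.coeff_mul]
        exact (norm_sum_le _ _).trans_eq (Finset.sum_congr rfl fun q _ => norm_mul _ _)
    _ = ∑ p ∈ Finset.HasAntidiagonal.antidiagonal k,
          ∑ q ∈ degreeIndices n p.1 ×ˢ degreeIndices n p.2,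
          ‖MvPowerSeries.coeff q.1 φ‖ * ‖MvPowerSeries.coeff q.2 ψ‖ := by
        rw [Finset.sum_sigma', Finset.sum_sigma']
        refine Finset.sum_bij' (fun x _ => ⟨(x.2.1.degree, x.2.2.degree), x.2⟩)
          (fun x _ => ⟨x.2.1 + x.2.2, x.2⟩) ?_ ?_ ?_ ?_ ?_
        · rintro ⟨α, β, γ⟩ h
          simp only [Finset.mem_sigma, mem_degreeIndices,
            Finset.HasAntidiagonal.mem_antidiagonal, Finset.mem_product] at *
          rw [← map_add, h.2, h.1]
          simp
        · rintro ⟨⟨i, j⟩, β, γ⟩ h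
          simp only [Finset.mem_sigma, mem_degreeIndices,
            Finset.HasAntidiagonal.mem_antidiagonal, Finset.mem_product] at *
          rw [map_add, h.2.1, h.2.2]
          exact ⟨h.1, trivial⟩
        · rintro ⟨α, β, γ⟩ h
          simp only [Finset.mem_sigma, mem_degreeIndices,
            Finset.HasAntidiagonal.mem_antidiagonal] at h
          simp only [h.2]
        · rintro ⟨⟨i, j⟩, β, γ⟩ h
          simp only [Finset.mem_sigma, mem_degreeIndices,
            Finset.HasAntidiagonal.mem_antidiagonal, Finset.mem_product] at h
          simp only [h.2.1, h.2.2]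
        · intro _ _
          rfl
    _ = _ := by
        refine Finset.sum_congr rfl fun p _ => ?_
        rw [Finset.sum_mul_sum, Finset.sum_product]

/-- `X` majorizes `φ` degree by degree. -/
def Majorizes (φ : MvPowerSeries (Fin n) ℂ) (X : PowerSeries ℝ) : Prop :=
  ∀ k, degNorm φ k ≤ PowerSeries.coeff k X

theorem Majorizes.mul {φ ψ : MvPowerSeries (Fin n) ℂ} {X Y : PowerSeries ℝ}
    (h : Majorizes φ X) (h' : Majorizes ψ Y) : Majorizes (φ * ψ) (X * Y) := by
  intro k
  rw [PowerSeries.coeff_mul]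
  refine (degNorm_mul_le φ ψ k).trans (Finset.sum_le_sum fun p _ => ?_)
  exact mul_le_mul (h _) (h' _) (degNorm_nonneg _ _) ((degNorm_nonneg _ _).trans (h _))

theorem Majorizes.one : Majorizes (1 : MvPowerSeries (Fin n) ℂ) 1 := by
  intro k
  rw [PowerSeries.coeff_one, degNorm]
  split_ifs with hk
  · rw [Finset.sum_eq_single 0]
    · simp
    · intro α _ hα
      rw [MvPowerSeries.coeff_one, if_neg hα, norm_zero]
    · intro h0
      exact absurd (mem_degreeIndices.2 (by simp [hk])) h0
  · refine (Finset.sum_eq_zero fun α hα => ?_).le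
    rw [MvPowerSeries.coeff_one, if_neg, norm_zero]
    rintro rfl
    rw [mem_degreeIndices, map_zero] at hα
    exact hk hα.symm

theorem Majorizes.pow {φ : MvPowerSeries (Fin n) ℂ} {X : PowerSeries ℝ} (h : Majorizes φ X)
    (m : ℕ) : Majorizes (φ ^ m) (X ^ m) := by
  induction m with
  | zero => simpa using Majorizes.one
  | succ m ih =>
    rw [pow_succ, pow_succ]
    exact ih.mul h

theorem Majorizes.prod {H : VSeries n} {X : PowerSeries ℝ} (h : ∀ i, Majorizes (H i) X)
    (β : Fin n →₀ ℕ) : Majorizes (β.prod fun i e => H i ^ e) (X ^ β.degree) := by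
  rw [Finsupp.degree_apply, Finsupp.prod]
  induction β.support using Finset.induction_on with
  | empty => simpa using Majorizes.one
  | insert a s ha ih =>
    rw [Finset.prod_insert ha, Finset.sum_insert ha, pow_add]
    exact ((h a).pow _).mul ih

/-- The sum over all components of the absolute values of the coefficients of degree `k`. -/
def vecNorm (f : VSeries n) (k : ℕ) : ℝ := ∑ j, degNorm (f j) k

theorem vecNorm_nonneg (f : VSeries n) (k : ℕ) : 0 ≤ vecNorm f k :=
  Finset.sum_nonneg fun _ _ => degNorm_nonneg _ _

theorem degNorm_le_vecNorm (f : VSeries n) (j : Fin n) (k : ℕ) : degNorm (f j) k ≤ vecNorm f k :=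
  Finset.single_le_sum (f := fun j => degNorm (f j) k) (fun _ _ => degNorm_nonneg _ _)
    (Finset.mem_univ j)

theorem norm_vcoeff_le_vecNorm (f : VSeries n) (α : Fin n →₀ ℕ) :
    ‖vcoeff f α‖ ≤ vecNorm f α.degree :=
  (pi_norm_le_iff_of_nonneg (vecNorm_nonneg _ _)).2 fun j =>
    (norm_coeff_le_degNorm (f j) α).trans (degNorm_le_vecNorm f j _)

theorem vecNorm_le (f : VSeries n) {k : ℕ} {c : ℝ} (hc : 0 ≤ c)
    (h : ∀ α : Fin n →₀ ℕ, α.degree = k → ‖vcoeff f α‖ ≤ c) :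
    vecNorm f k ≤ n * ((2 ^ n) ^ k * c) := by
  have h1 : ∀ j, degNorm (f j) k ≤ (2 ^ n) ^ k * c := by
    intro j
    refine (Finset.sum_le_card_nsmul _ _ c fun α hα => ?_).trans ?_
    · exact (norm_le_pi_norm (vcoeff f α) j).trans (h α (mem_degreeIndices.1 hα))
    · rw [nsmul_eq_mul]
      refine mul_le_mul_of_nonneg_right ?_ hc
      exact_mod_cast card_degreeIndices_le n k
  refine (Finset.sum_le_card_nsmul _ _ _ fun j _ => h1 j).trans ?_
  simp

theorem coeff_pow_eq_of_constantCoeff {X Y : PowerSeries ℝ} (hXY : X = PowerSeries.X * Y)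
    (m k : ℕ) : PowerSeries.coeff k (X ^ m) =
      if m ≤ k then PowerSeries.coeff (k - m) (Y ^ m) else 0 := by
  rw [hXY, mul_pow, PowerSeries.coeff_X_pow_mul']

/-- The majorant of the components of `H`, divided by the variable. -/
def shiftedMajorant (H : VSeries n) : PowerSeries ℝ := PowerSeries.mk fun w => vecNorm H (w + 1)

theorem majorizes_of_constantCoeff {H : VSeries n} (hH : ∀ i, MvPowerSeries.coeff 0 (H i) = 0)
    (i : Fin n) : Majorizes (H i) (PowerSeries.X * shiftedMajorant H) := by
  intro k
  cases k with
  | zero =>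
    rw [PowerSeries.coeff_zero_X_mul, degNorm]
    refine (Finset.sum_eq_zero fun α hα => ?_).le
    rw [mem_degreeIndices, Finsupp.degree_eq_zero_iff] at hα
    rw [hα, hH, norm_zero]
  | succ k =>
    rw [PowerSeries.coeff_succ_X_mul, shiftedMajorant, PowerSeries.coeff_mk]
    exact degNorm_le_vecNorm H i _

theorem coeff_zero_changeVar {h : VSeries n} (hh : h ∈ V n 1) (i : Fin n) :
    MvPowerSeries.coeff 0 (changeVar h i) = 0 := by
  rw [changeVar, map_add, MvPowerSeries.coeff_zero_X, zero_add]
  exact congrFun (hh 0 (by simp)) i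

theorem degNorm_prod_le {h : VSeries n} (hh : h ∈ V n 1) (β : Fin n →₀ ℕ) (k : ℕ) :
    degNorm (β.prod fun i e => changeVar h i ^ e) k ≤
      if β.degree ≤ k then
        PowerSeries.coeff (k - β.degree) (shiftedMajorant (changeVar h) ^ β.degree) else 0 := by
  rw [← coeff_pow_eq_of_constantCoeff rfl]
  exact Majorizes.prod (majorizes_of_constantCoeff (coeff_zero_changeVar hh)) β k

theorem norm_coeff_subst_le {h : VSeries n} (hh : h ∈ V n 1) (φ : MvPowerSeries (Fin n) ℂ)
    (α : Fin n →₀ ℕ) :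
    ‖MvPowerSeries.coeff α (MvPowerSeries.subst (changeVar h) φ)‖ ≤
      ∑ m ∈ Finset.range (α.degree + 1), ∑ β ∈ degreeIndices n m, ‖MvPowerSeries.coeff β φ‖ *
        ‖MvPowerSeries.coeff α (β.prod fun i e => changeVar h i ^ e)‖ := by
  have hsub : (Function.support fun β : Fin n →₀ ℕ => MvPowerSeries.coeff β φ •
      MvPowerSeries.coeff α (β.prod fun i e => changeVar h i ^ e)) ⊆
      ↑((Finset.range (α.degree + 1)).biUnion (degreeIndices n)) := by
    intro β hβ
    simp only [Finset.coe_biUnion, Finset.mem_coe, Set.mem_iUnion, Finset.mem_range,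
      mem_degreeIndices, exists_prop, exists_eq_right']
    by_contra hlt
    refine hβ ?_
    have h1 := degNorm_prod_le hh β α.degree
    rw [if_neg (by omega)] at h1
    have h2 := (norm_coeff_le_degNorm _ α).trans h1
    exact smul_eq_zero_of_right _ (norm_le_zero_iff.1 h2)
  rw [MvPowerSeries.coeff_subst (hasSubst_changeVar hh), finsum_eq_sum_of_support_subset _ hsub,
    Finset.sum_biUnion]
  · refine (norm_sum_le _ _).trans (Finset.sum_le_sum fun m _ => ?_)
    refine (norm_sum_le _ _).trans (Finset.sum_le_sum fun β _ => ?_)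
    rw [smul_eq_mul, norm_mul]
  · intro a _ b _ hab
    rw [Function.onFun, Finset.disjoint_left]
    intro β hβ hβ'
    rw [mem_degreeIndices] at hβ hβ'
    exact hab (hβ.symm.trans hβ')

/-- Each monomial of degree `m` in `H` is majorized by the `m`-th power of a series divisible by the
variable. Dividing out `m` variables shifts `v + 2` to `v + 2 - m`, and `f` starts at `m = 2`. -/
theorem vecNorm_subst_le {h : VSeries n} (hh : h ∈ V n 1) {f : VSeries n} (hf : f ∈ V n 1)
    (v : ℕ) :
    ∑ j, degNorm (MvPowerSeries.subst (changeVar h) (f j)) (v + 2) ≤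
      ∑ p ∈ Finset.HasAntidiagonal.antidiagonal v, vecNorm f (p.1 + 2) *
        PowerSeries.coeff p.2 (shiftedMajorant (changeVar h) ^ (p.1 + 2)) := by
  have hcomp : ∀ j, degNorm (MvPowerSeries.subst (changeVar h) (f j)) (v + 2) ≤
      ∑ p ∈ Finset.HasAntidiagonal.antidiagonal v, degNorm (f j) (p.1 + 2) *
        PowerSeries.coeff p.2 (shiftedMajorant (changeVar h) ^ (p.1 + 2)) := by
    intro j
    have hlow : ∀ m, m ≤ 1 → degNorm (f j) m = 0 := by
      intro m hm
      refine Finset.sum_eq_zero fun β hβ => ?_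
      have h1 : MvPowerSeries.coeff β (f j) = 0 :=
        congrFun (hf β (by rw [mem_degreeIndices.1 hβ]; exact hm)) j
      rw [h1, norm_zero]
    have h1 : degNorm (MvPowerSeries.subst (changeVar h) (f j)) (v + 2) ≤
        ∑ m ∈ Finset.range (v + 3), degNorm (f j) m *
          PowerSeries.coeff (v + 2 - m) (shiftedMajorant (changeVar h) ^ m) := by
      calc degNorm (MvPowerSeries.subst (changeVar h) (f j)) (v + 2)
          ≤ ∑ α ∈ degreeIndices n (v + 2), ∑ m ∈ Finset.range (v + 3),
              ∑ β ∈ degreeIndices n m, ‖MvPowerSeries.coeff β (f j)‖ *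
              ‖MvPowerSeries.coeff α (β.prod fun i e => changeVar h i ^ e)‖ := by
            refine Finset.sum_le_sum fun α hα => ?_
            have := norm_coeff_subst_le hh (f j) α
            rwa [mem_degreeIndices.1 hα] at this
        _ = ∑ m ∈ Finset.range (v + 3), ∑ β ∈ degreeIndices n m, ‖MvPowerSeries.coeff β (f j)‖ *
              degNorm (β.prod fun i e => changeVar h i ^ e) (v + 2) := by
            rw [Finset.sum_comm]
            refine Finset.sum_congr rfl fun m _ => ?_
            rw [Finset.sum_comm]
            refine Finset.sum_congr rfl fun β _ => ?_
            rw [degNorm, Finset.mul_sum]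
        _ ≤ _ := by
            refine Finset.sum_le_sum fun m hm => ?_
            rw [degNorm, Finset.sum_mul]
            refine Finset.sum_le_sum fun β hβ => ?_
            refine mul_le_mul_of_nonneg_left ?_ (norm_nonneg _)
            have := degNorm_prod_le hh β (v + 2)
            rwa [mem_degreeIndices.1 hβ, if_pos (by rw [Finset.mem_range] at hm; omega)] at this
    refine h1.trans_eq ?_
    rw [Finset.sum_range_succ', Finset.sum_range_succ', hlow 0 (by omega), hlow (0 + 1) (by omega),
      zero_mul, zero_mul, add_zero, add_zero,
      Finset.Nat.sum_antidiagonal_eq_sum_range_succ_mk]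
    refine Finset.sum_congr rfl fun i _ => ?_
    rw [show v + 2 - (i + 1 + 1) = v - i by omega]
  refine (Finset.sum_le_sum fun j _ => hcomp j).trans_eq ?_
  rw [Finset.sum_comm]
  refine Finset.sum_congr rfl fun p _ => ?_
  rw [vecNorm, Finset.sum_mul]

/-- The recursive inequality satisfied by the coefficients of a linearization. -/
theorem IsLinearization.vecNorm_recursive {lam : Fin n → ℂ} {F h : VSeries n}
    (hF : F - linearField lam ∈ V n 1) (hh : IsLinearization lam F h) {v : ℕ} {d : ℝ}
    (hd : ∀ j (α : Fin n →₀ ℕ), α.degree = v + 2 → d ≤ ‖divisor lam j α‖) :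
    d * vecNorm (changeVar h) (v + 2) ≤
      ∑ p ∈ Finset.HasAntidiagonal.antidiagonal v, vecNorm (F - linearField lam) (p.1 + 2) *
        PowerSeries.coeff p.2 (shiftedMajorant (changeVar h) ^ (p.1 + 2)) := by
  rw [isLinearization_iff] at hh
  refine le_trans ?_ (vecNorm_subst_le hh.1 hF v)
  rw [vecNorm, Finset.mul_sum]
  refine Finset.sum_le_sum fun j _ => ?_
  rw [degNorm, Finset.mul_sum]
  refine Finset.sum_le_sum fun α hα => ?_
  have hα' := mem_degreeIndices.1 hα
  rw [← hh.2 j α, norm_mul, coeff_changeVar_of_two_le h j (by omega)]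
  exact mul_le_mul_of_nonneg_right (hd j α hα') (norm_nonneg _)

end

/-! ### Coefficient estimates for `λ = (-1, ω)` -/

theorem divisorDist_le_norm_divisor (ω : ℝ) (j : Fin 2) {α : Fin 2 →₀ ℕ} {w : ℕ}
    (hα : α.degree = w + 1) : divisorDist ω w ≤ ‖divisor ![(-1 : ℂ), (ω : ℂ)] j α‖ := by
  rw [Finsupp.degree_eq_sum, Fin.sum_univ_two] at hα
  have hα' : (α 0 : ℝ) + α 1 = w + 1 := by exact_mod_cast hα
  have key : ∀ q : ℤ, divisor ![(-1 : ℂ), (ω : ℂ)] j α = ((q * (1 + ω) - w : ℝ) : ℂ) →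
      divisorDist ω w ≤ ‖divisor ![(-1 : ℂ), (ω : ℂ)] j α‖ := by
    intro q hq
    rw [hq, Complex.norm_real, Real.norm_eq_abs]
    exact divisorDist_le (w : ℤ) q
  have hC : (α 0 : ℂ) + α 1 = w + 1 := by exact_mod_cast hα
  fin_cases j
  · refine key (α 1) ?_
    simp only [divisor, Fin.sum_univ_two, Fin.zero_eta, Matrix.cons_val_zero, Matrix.cons_val_one]
    push_cast
    linear_combination -hC
  · refine key (α 1 - 1) ?_
    simp only [divisor, Fin.sum_univ_two, Fin.mk_one, Matrix.cons_val_zero, Matrix.cons_val_one]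
    push_cast
    linear_combination -hC

theorem divisor_ne_zero {ω : ℝ} (hω : Irrational ω) (j : Fin 2) (α : Fin 2 →₀ ℕ)
    (hα : 2 ≤ α.degree) : divisor ![(-1 : ℂ), (ω : ℂ)] j α ≠ 0 := by
  obtain ⟨w, hw⟩ : ∃ w, α.degree = w + 1 := ⟨α.degree - 1, by omega⟩
  rw [← norm_pos_iff]
  exact (divisorDist_pos hω (by omega)).trans_le (divisorDist_le_norm_divisor ω j hw)

theorem vcoeff_sub_linearField {n : ℕ} (lam : Fin n → ℂ) (F : VSeries n) {α : Fin n →₀ ℕ}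
    (hα : 2 ≤ α.degree) : vcoeff (F - linearField lam) α = vcoeff F α := by
  funext j
  rw [vcoeff, vcoeff, Pi.sub_apply, map_sub, linearField, MvPowerSeries.coeff_C_mul,
    MvPowerSeries.coeff_X, if_neg, mul_zero, sub_zero]
  rintro rfl
  rw [Finsupp.degree_single] at hα
  omega

theorem norm_vcoeff_le_vecNorm_changeVar {n : ℕ} {h : VSeries n} (hh : h ∈ V n 1)
    (α : Fin n →₀ ℕ) : ‖vcoeff h α‖ ≤ vecNorm (changeVar h) α.degree := by
  rcases le_or_gt α.degree 1 with hα | hα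
  · rw [hh α hα, norm_zero]
    exact vecNorm_nonneg _ _
  · have e : vcoeff h α = vcoeff (changeVar h) α :=
      funext fun j => (coeff_changeVar_of_two_le h j hα).symm
    rw [e]
    exact norm_vcoeff_le_vecNorm _ _

/-- The coefficients of the linearization are bounded by those of the vector field, up to a
geometric factor and the exponential of the partial Bruno sums. -/
theorem IsLinearization.norm_vcoeff_le {ω : ℝ} (hpos : 0 < ω) (hω : Irrational ω)
    {F h : VSeries 2} (hF : F - linearField ![(-1 : ℂ), (ω : ℂ)] ∈ V 2 1)
    (hh : IsLinearization ![(-1 : ℂ), (ω : ℂ)] F h) {M : ℕ → ℝ} (hM : ∀ k, 1 ≤ k → 0 < M k)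
    (hmul : ∀ k l, 1 ≤ k → 1 ≤ l → M k * M l ≤ M (k + l - 1)) (hFM : F ∈ weightClass 2 M) :
    ∃ A B : ℝ, 0 < A ∧ 0 < B ∧ ∀ α : Fin 2 →₀ ℕ, α ≠ 0 →
      ‖vcoeff h α‖ ≤ A * B ^ α.degree *
        (M α.degree * Real.exp (α.degree * brunoPartialSum ω α)) := by
  obtain ⟨A₀, B₀, hA₀, hB₀, hF₀⟩ := hFM
  obtain ⟨A, B, hA, hB, hbound⟩ := weighted_bound_of_recursive
    (s := fun w => vecNorm (changeVar h) (w + 1)) (P := fun w => M (w + 1)) (K := potential ω)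
    (d := fun w => divisorDist ω w)
    (φ := vecNorm (F - linearField ![(-1 : ℂ), (ω : ℂ)])) (A := 2 * A₀) (B := 2 ^ 2 * B₀)
    (fun _ => vecNorm_nonneg _ _) (fun k => hM _ (by omega))
    -- Condition 3), with indices shifted by one, is supermultiplicativity.
    (fun k l => by
      have h1 := hmul (k + 1) (l + 1) (by omega) (by omega)
      rwa [show k + 1 + (l + 1) - 1 = k + l + 1 by omega] at h1)
    (potential_add_le hpos hω) (monotone_nat_of_le_succ (potential_le_succ hpos hω))
    (fun k => divisorDist_pos hω (by omega)) (fun k => log_le_potential_sub hpos hω k)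
    (by positivity) (by positivity)
    (fun i => by
      have hMi := hM (i + 2) (by omega)
      refine (vecNorm_le _ (c := A₀ * B₀ ^ (i + 2) * M (i + 2)) (by positivity) ?_).trans_eq ?_
      · intro α hα
        rw [vcoeff_sub_linearField _ _ (by omega), ← hα]
        refine hF₀ α ?_
        rintro rfl
        simp at hα
      · push_cast
        rw [mul_pow]
        ring)
    (fun v => hh.vecNorm_recursive hF fun j α hα => divisorDist_le_norm_divisor ω j hα)
  obtain ⟨C, hC⟩ := potential_le hpos hω
  -- The bound is geometric in `w = |α| - 1`; the division restores the exponent `|α|`.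
  refine ⟨A / (B * Real.exp C), B * Real.exp C, by positivity, by positivity, fun α hα => ?_⟩
  obtain ⟨w, hw⟩ : ∃ w, α.degree = w + 1 := by
    refine Nat.exists_eq_succ_of_ne_zero fun h0 => hα ?_
    rwa [Finsupp.degree_eq_zero_iff] at h0
  refine (norm_vcoeff_le_vecNorm_changeVar hh.1 α).trans ?_
  have hS : 0 ≤ brunoPartialSum ω α := Finset.sum_nonneg fun m _ =>
    div_nonneg (Real.log_nonneg (one_le_convDen hω _)) (zero_le_one.trans (one_le_convDen hω _))
  have hK : potential ω w ≤ w * C + (w + 1 : ℕ) * brunoPartialSum ω α := by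
    have h1 := hC w
    rw [← hw] at h1
    change potential ω w ≤ w * (C + brunoPartialSum ω α) at h1
    push_cast
    linarith
  have hMw := hM (w + 1) (by omega)
  rw [hw]
  refine (hbound w).trans ?_
  calc A * B ^ w * (M (w + 1) * Real.exp (potential ω w))
      ≤ A * B ^ w * (M (w + 1) * Real.exp (w * C + (w + 1 : ℕ) * brunoPartialSum ω α)) := by
        gcongr
    _ = _ := by
        rw [Real.exp_add, Real.exp_nat_mul]
        field_simp
        ring

theorem mem_weightClass_of_eventually {n : ℕ} {N : ℕ → ℝ} (hN : ∀ k, 1 ≤ k → 0 < N k)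
    {h : VSeries n} {A B : ℝ} (hA : 0 < A) (hB : 0 < B)
    (hev : ∀ᶠ k in atTop, ∀ α : Fin n →₀ ℕ, α.degree = k →
      ‖vcoeff h α‖ ≤ A * B ^ α.degree * N α.degree) : h ∈ weightClass n N := by
  obtain ⟨k₀, hk₀⟩ := eventually_atTop.1 hev
  -- The absolute value keeps the term `k = 0` nonnegative, as the sign of `N 0` is unknown.
  have hterm : ∀ k, 0 ≤ vecNorm h k / (B ^ k * |N k|) := fun k =>
    div_nonneg (vecNorm_nonneg _ _) (by positivity)
  have hsum : 0 ≤ ∑ k ∈ Finset.range k₀, vecNorm h k / (B ^ k * |N k|) :=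
    Finset.sum_nonneg fun k _ => hterm k
  refine ⟨A + ∑ k ∈ Finset.range k₀, vecNorm h k / (B ^ k * |N k|), B, by positivity, hB,
    fun α hα => ?_⟩
  have hdeg : 1 ≤ α.degree := by
    rw [Nat.one_le_iff_ne_zero, Ne, Finsupp.degree_eq_zero_iff]
    exact hα
  have hNα := hN _ hdeg
  rcases le_or_gt k₀ α.degree with hk | hk
  · refine (hk₀ _ hk α rfl).trans ?_
    gcongr
    linarith
  · have h1 := Finset.single_le_sum (f := fun k => vecNorm h k / (B ^ k * |N k|))
      (fun k _ => hterm k) (Finset.mem_range.2 hk)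
    have hpos : 0 < B ^ α.degree * N α.degree := by positivity
    simp only [abs_of_pos hNα] at h1
    rw [div_le_iff₀ hpos] at h1
    refine (norm_vcoeff_le_vecNorm h α).trans (h1.trans ?_)
    rw [mul_assoc]
    refine mul_le_mul_of_nonneg_right ?_ hpos.le
    linarith

theorem LimsupFinite.exists_eventually_le {u : (Fin 2 →₀ ℕ) → ℝ} (hu : LimsupFinite u) :
    ∃ c : ℝ, ∀ᶠ k in atTop, ∀ α : Fin 2 →₀ ℕ, α.degree = k → u α ≤ c := by
  obtain ⟨c, hc, -⟩ := EReal.lt_iff_exists_real_btwn.1 hu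
  refine ⟨c, ?_⟩
  have h1 := eventually_lt_of_limsup_lt hc
  rw [eventually_comap] at h1
  filter_upwards [h1] with k hk α hα
  exact_mod_cast (hk α hα).le

/-- Multiplying the limsup bound by `|α|` and exponentiating turns the Bruno factor into `exp(c)^|α|
* N / M`, for all large degrees. -/
theorem mem_weightClass_of_bruno_bound {ω : ℝ} {M N : ℕ → ℝ} (hM : ∀ k, 1 ≤ k → 0 < M k)
    (hN : ∀ k, 1 ≤ k → 0 < N k) {h : VSeries 2}
    (hh : ∃ A B : ℝ, 0 < A ∧ 0 < B ∧ ∀ α : Fin 2 →₀ ℕ, α ≠ 0 →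
      ‖vcoeff h α‖ ≤ A * B ^ α.degree *
        (M α.degree * Real.exp (α.degree * brunoPartialSum ω α)))
    (hlim : LimsupFinite fun α => brunoPartialSum ω α -
      1 / (α.degree : ℝ) * Real.log (N α.degree / M α.degree)) : h ∈ weightClass 2 N := by
  obtain ⟨A, B, hA, hB, hb⟩ := hh
  obtain ⟨c, hc⟩ := hlim.exists_eventually_le
  refine mem_weightClass_of_eventually hN hA (B := B * Real.exp c) (by positivity) ?_
  filter_upwards [hc, eventually_ge_atTop 1] with k hk hk1 α hα
  have hMk := hM k hk1
  have hNk := hN k hk1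
  have h1 := hk α hα
  have hα0 : α ≠ 0 := by
    rintro rfl
    rw [map_zero] at hα
    omega
  refine (hb α hα0).trans ?_
  rw [hα] at *
  have hk0 : (0 : ℝ) < k := by exact_mod_cast hk1
  have h2 : k * brunoPartialSum ω α ≤ k * c + Real.log (N k / M k) := by
    have h3 := mul_le_mul_of_nonneg_left h1 hk0.le
    rw [mul_sub, ← mul_assoc, mul_one_div_cancel hk0.ne', one_mul] at h3
    linarith
  calc A * B ^ k * (M k * Real.exp (k * brunoPartialSum ω α))
      ≤ A * B ^ k * (M k * Real.exp (k * c + Real.log (N k / M k))) := by gcongr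
    _ = A * (B * Real.exp c) ^ k * N k := by
        rw [Real.exp_add, Real.exp_log (by positivity), Real.exp_nat_mul, mul_pow]
        field_simp

theorem IsAnalyticGerm.mem_weightClass {n : ℕ} {F : VSeries n} (hF : IsAnalyticGerm F) :
    F ∈ weightClass n fun _ => 1 := by
  obtain ⟨r, hr, hsum⟩ := hF
  have h0 : ∀ α : Fin n →₀ ℕ, 0 ≤ ‖vcoeff F α‖ * r ^ α.degree := fun α => by positivity
  have hnn : 0 ≤ ∑' α : Fin n →₀ ℕ, ‖vcoeff F α‖ * r ^ α.degree := tsum_nonneg h0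
  refine ⟨1 + ∑' α : Fin n →₀ ℕ, ‖vcoeff F α‖ * r ^ α.degree, r⁻¹,
    by linarith, by positivity, fun α _ => ?_⟩
  have h1 := hsum.le_tsum α fun β _ => h0 β
  rw [mul_one, inv_pow, ← div_eq_mul_inv, le_div_iff₀ (by positivity)]
  linarith

theorem IsBruno.brunoPartialSum_le {ω : ℝ} (h : IsBruno ω) (α : Fin 2 →₀ ℕ) :
    brunoPartialSum ω α ≤ ∑' k, Real.log (convDen ω (k + 1)) / convDen ω k :=
  h.2.sum_le_tsum _ fun _ _ => div_nonneg (Real.log_nonneg (one_le_convDen h.1 _))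
    (zero_le_one.trans (one_le_convDen h.1 _))

theorem mem_weightClass_of_isBruno {ω : ℝ} (hω : IsBruno ω) {M : ℕ → ℝ}
    (hM : ∀ k, 1 ≤ k → 0 < M k) {h : VSeries 2}
    (hh : ∃ A B : ℝ, 0 < A ∧ 0 < B ∧ ∀ α : Fin 2 →₀ ℕ, α ≠ 0 →
      ‖vcoeff h α‖ ≤ A * B ^ α.degree *
        (M α.degree * Real.exp (α.degree * brunoPartialSum ω α))) : h ∈ weightClass 2 M := by
  obtain ⟨A, B, hA, hB, hb⟩ := hh
  refine ⟨A, B * Real.exp (∑' k, Real.log (convDen ω (k + 1)) / convDen ω k), hA, by positivity,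
    fun α hα => (hb α hα).trans ?_⟩
  have hdeg : 1 ≤ α.degree := by
    rw [Nat.one_le_iff_ne_zero, Ne, Finsupp.degree_eq_zero_iff]
    exact hα
  have hMα := hM _ hdeg
  rw [mul_pow, ← Real.exp_nat_mul]
  calc A * B ^ α.degree * (M α.degree * Real.exp (α.degree * brunoPartialSum ω α))
      ≤ A * B ^ α.degree * (M α.degree *
        Real.exp (α.degree * ∑' k, Real.log (convDen ω (k + 1)) / convDen ω k)) := by
        gcongr
        exact hω.brunoPartialSum_le α
    _ = _ := by ring

end

end UltraVF

/-! ### The main theorem -/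

theorem mainTheorem8 (ω : ℝ) (hω : 0 < ω) (hirr : Irrational ω)
    (F : UltraVF.VSeries 2)
    (hF : F - UltraVF.linearField ![(-1 : ℂ), (ω : ℂ)] ∈ UltraVF.V 2 1)
    (M N : ℕ → ℝ) (hM : UltraVF.IsWeightSeq M) (hN : UltraVF.IsWeightSeq N) :
    (∃! h : UltraVF.VSeries 2, UltraVF.IsLinearization ![(-1 : ℂ), (ω : ℂ)] F h) ∧
    ∀ h : UltraVF.VSeries 2, UltraVF.IsLinearization ![(-1 : ℂ), (ω : ℂ)] F h →
      (F ∈ UltraVF.weightClass 2 M → UltraVF.IsBruno ω →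
        h ∈ UltraVF.weightClass 2 M ∩ UltraVF.V 2 1) ∧
      (UltraVF.IsAnalyticGerm F →
        UltraVF.LimsupFinite (fun α =>
          UltraVF.brunoPartialSum ω α - 1 / (α.degree : ℝ) * Real.log (N α.degree)) →
        h ∈ UltraVF.weightClass 2 N ∩ UltraVF.V 2 1) ∧
      (F ∈ UltraVF.weightClass 2 M → (∀ᶠ k in Filter.atTop, M k ≤ N k) →
        UltraVF.LimsupFinite (fun α =>
          UltraVF.brunoPartialSum ω α -
            1 / (α.degree : ℝ) * Real.log (N α.degree / M α.degree)) →
        h ∈ UltraVF.weightClass 2 N ∩ UltraVF.V 2 1) := by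
  refine ⟨?_, fun h hh => ⟨fun hFM hB => ⟨?_, hh.1⟩, fun hFa hlim => ⟨?_, hh.1⟩,
    fun hFM _ hlim => ⟨?_, hh.1⟩⟩⟩
  · obtain ⟨h, hh⟩ := UltraVF.exists_isLinearization (UltraVF.divisor_ne_zero hirr) hF
    exact ⟨h, hh, fun h' hh' => hh'.unique (UltraVF.divisor_ne_zero hirr) hF hh⟩
  · exact UltraVF.mem_weightClass_of_isBruno hB hM.pos
      (hh.norm_vcoeff_le hω hirr hF hM.pos hM.mul_le hFM)
  -- The analytic case is the weighted one with constant weight 1, which is positive and satisfies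
  -- condition 3).
  · refine UltraVF.mem_weightClass_of_bruno_bound (M := fun _ => 1) (fun _ _ => one_pos) hN.pos
      (hh.norm_vcoeff_le hω hirr hF (fun _ _ => one_pos) (fun _ _ _ _ => by norm_num)
        hFa.mem_weightClass) ?_
    simpa only [div_one] using hlim
  · exact UltraVF.mem_weightClass_of_bruno_bound hM.pos hN.pos
      (hh.norm_vcoeff_le hω hirr hF hM.pos hM.mul_le hFM) hlim
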